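/- Rings are associative but need not have an identity. A ring $R$ is \emph{nil} if every element of $R$ is nilpotent, and an ideal (right, left or two-sided) is nil if all its elements are nilpotent. $R[x]$ denotes the polynomial ring in one indeterminate over $R$. A right ideal $Q$ of a ring $S$ is \emph{modular} if there is $b\in S$ with $a-ba\in Q$ for all $a\in S$; it is \emph{maximal} if it is maximal among the right ideals different from $S$. A two-sided ideal $P$ of $S$ is \emph{right primitive} if there is a modular maximal right ideal $Q$ of $S$ such that $P$ is the largest two-sided ideal of $S$ contained in $Q$; the ring $S$ is \emph{right primitive} if its zero ideal is right primitive. The following two statements are equivalent: 1. (Köthe conjecture) If a ring has no nonzero nil two-sided ideals, then it has no nonzero nil one-sided (right or left) ideals. 2. For every nil ring $R$, the polynomial ring $R[x]$ is not right primitive. -/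

import Mathlib

/-! Rings are associative and need not have an identity (`NonUnitalRing`). -/

universe u

section Polynomials

/-- The polynomial ring `R[x]` in one indeterminate over a ring `R` that need not have an identity:
its elements are the finitely supported sequences of coefficients. -/
def RngPoly (R : Type*) [NonUnitalRing R] : Type _ := ℕ →₀ R

namespace RngPoly

variable {R : Type*} [NonUnitalRing R]

noncomputable instance : AddCommGroup (RngPoly R) := inferInstanceAs (AddCommGroup (ℕ →₀ R))

/-- The coefficient of `x ^ n`. -/
def coeff (f : RngPoly R) (n : ℕ) : R := Finsupp.toFun f n

/-- The monomial `a x ^ n`. -/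
noncomputable def monomial (n : ℕ) : R →+ RngPoly R := Finsupp.singleAddHom n

/-- The product: `(∑ aᵢ xⁱ) (∑ bⱼ xʲ) = ∑ aᵢ bⱼ xⁱ⁺ʲ`. -/
noncomputable instance : Mul (RngPoly R) :=
  ⟨fun f g => Finsupp.sum f fun i a => Finsupp.sum g fun j b => monomial (i + j) (a * b)⟩

theorem mul_def (f g : RngPoly R) :
    f * g = Finsupp.sum f fun i a => Finsupp.sum g fun j b => monomial (i + j) (a * b) := rfl

theorem induction_on {p : RngPoly R → Prop} (f : RngPoly R) (zero : p 0)
    (add : ∀ f g, p f → p g → p (f + g)) (mono : ∀ n a, p (monomial n a)) : p f :=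
  Finsupp.induction_linear (motive := p) f zero add mono

theorem monomial_mul_monomial (i j : ℕ) (a b : R) :
    monomial i a * monomial j b = monomial (i + j) (a * b) := by
  rw [mul_def]
  refine (Finsupp.sum_single_index ?_).trans (Finsupp.sum_single_index ?_)
  · simp only [zero_mul, map_zero]
    exact Finset.sum_const_zero
  · simp

theorem left_distrib' (f g h : RngPoly R) : f * (g + h) = f * g + f * h := by
  simp only [mul_def]
  refine (Finset.sum_congr rfl fun i _ => Finsupp.sum_add_index' ?_ ?_).trans
    Finset.sum_add_distrib
  · simp
  · intro j a b
    simp [mul_add]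

theorem right_distrib' (f g h : RngPoly R) : (f + g) * h = f * h + g * h := by
  simp only [mul_def]
  refine Finsupp.sum_add_index' ?_ ?_
  · intro i
    simp only [zero_mul, map_zero]
    exact Finset.sum_const_zero
  · intro i a b
    simp only [add_mul, map_add]
    exact Finset.sum_add_distrib

noncomputable instance : NonUnitalNonAssocRing (RngPoly R) where
  left_distrib := left_distrib'
  right_distrib := right_distrib'
  zero_mul f := by simpa using right_distrib' 0 0 f
  mul_zero f := by simpa using left_distrib' f 0 0

noncomputable instance : NonUnitalRing (RngPoly R) where
  mul_assoc f g h := by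
    induction f using induction_on with
    | zero => simp
    | add f f' hf hf' => simp only [add_mul, hf, hf']
    | mono i a =>
      induction g using induction_on with
      | zero => simp
      | add g g' hg hg' => simp only [mul_add, add_mul, hg, hg']
      | mono j b =>
        induction h using induction_on with
        | zero => simp
        | add h h' hh hh' => simp only [mul_add, hh, hh']
        | mono k c => simp only [monomial_mul_monomial, mul_assoc, add_assoc]

end RngPoly

end Polynomials

section Notions

/-- `rngPow a n` is the power `a ^ (n + 1)`. -/
def rngPow {R : Type*} [NonUnitalRing R] (a : R) : ℕ → R
  | 0 => a
  | n + 1 => rngPow a n * a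

/-- `a` is nilpotent: some power of `a` with positive exponent is zero. -/
def RngNilpotent {R : Type*} [NonUnitalRing R] (a : R) : Prop :=
  ∃ n, rngPow a n = 0

/-- `R` is a nil ring: all its elements are nilpotent. -/
def IsNilRing (R : Type*) [NonUnitalRing R] : Prop :=
  ∀ a : R, RngNilpotent a

/-- An additive subgroup that is a right ideal. -/
def IsRightIdeal {R : Type*} [NonUnitalRing R] (Q : AddSubgroup R) : Prop :=
  ∀ q ∈ Q, ∀ r : R, q * r ∈ Q

/-- An additive subgroup that is a left ideal. -/
def IsLeftIdeal {R : Type*} [NonUnitalRing R] (Q : AddSubgroup R) : Prop :=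
  ∀ q ∈ Q, ∀ r : R, r * q ∈ Q

/-- A maximal right ideal: maximal among the proper right ideals. -/
def IsMaximalRightIdeal {R : Type*} [NonUnitalRing R] (Q : AddSubgroup R) : Prop :=
  Maximal (fun Q' : AddSubgroup R => IsRightIdeal Q' ∧ Q' ≠ ⊤) Q

/-- A right ideal `Q` is modular if some `b` satisfies `a - b a ∈ Q` for all `a`. -/
def IsModularRightIdeal {R : Type*} [NonUnitalRing R] (Q : AddSubgroup R) : Prop :=
  IsRightIdeal Q ∧ ∃ b : R, ∀ a : R, a - b * a ∈ Q

/-- A right primitive ideal: the largest two-sided ideal contained in some modular maximal right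
ideal. -/
def IsRightPrimitiveIdeal {R : Type*} [NonUnitalRing R] (P : TwoSidedIdeal R) : Prop :=
  ∃ Q : AddSubgroup R, IsMaximalRightIdeal Q ∧ IsModularRightIdeal Q ∧
    IsGreatest {I : TwoSidedIdeal R | ∀ a ∈ I, a ∈ Q} P

/-- A right primitive ring: its zero ideal is right primitive. -/
def IsRightPrimitiveRing (R : Type*) [NonUnitalRing R] : Prop :=
  IsRightPrimitiveIdeal (⊥ : TwoSidedIdeal R)

/-- The Köthe conjecture (for rings in the universe `u`): a ring without nonzero nil two-sided
ideals has no nonzero nil one-sided ideals, right or left. -/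
def KoetheConjecture : Prop :=
  ∀ (R : Type u) [NonUnitalRing R],
    (∀ I : TwoSidedIdeal R, (∀ a ∈ I, RngNilpotent a) → I = ⊥) →
    ∀ Q : AddSubgroup R, IsRightIdeal Q ∨ IsLeftIdeal Q → (∀ a ∈ Q, RngNilpotent a) → Q = ⊥

end Notions

/-! Both statements are equivalent to a third: over a nil ring R, every g in R[x] has the form g = a
- g a.

Such quasi-regularity puts the left unit b of a modular Q into Q, so it excludes primitivity.
Conversely, a g that is not quasi-regular yields a modular maximal right ideal Q. The crux
(`RngPoly.mul_coeff_mem`) is that the annihilator of the simple module V = R[x]/Q is I[x] for an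
ideal I of R, so (R/I)[x] is right primitive while R/I is nil.

For the crux, x acts invertibly on V. Suppose x satisfied a relation whose leading coefficient does
not annihilate V. Then there is a length such that, for each y ≠ 0, every vector is carried into the
window of that length on y by an ideal not annihilating V. If h + 1 is the least such length, some v
has vR, ..., vR x^h independent. Expanding v repeatedly puts a translate of v into its window
(`LaurentModule.exists_T_mem_window`); independence and nilness forbid this
(`LaurentModule.T_notMem_window`).

Quasi-regularity implies Köthe because constants in the Jacobson radical of a polynomial ring are
nilpotent, and nil one-sided ideals consist of such constants. Köthe implies quasi-regularity
because it makes matrices over nil rings nilpotent, and a companion matrix then inverts 1 - f. -/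

/-! ### Simple modules with invertible x: no algebraic relation -/

/-- A simple right module over `R[x]` on which `x` acts invertibly: `T j` is the action of `x ^ j`. -/
structure LaurentModule (R V : Type*) [NonUnitalRing R] [AddCommGroup V] where
  /-- The right action of the coefficient ring. -/
  act : V →+ R →+ V
  /-- The action of the powers of the indeterminate. -/
  T : ℤ → AddMonoid.End V
  act_act : ∀ v r s, act (act v r) s = act v (r * s)
  T_zero : ∀ v, T 0 v = v
  T_add : ∀ i j v, T (i + j) v = T i (T j v)
  T_act : ∀ j v r, T j (act v r) = act (T j v) r
  simple : ∀ v, v ≠ 0 → ∀ w, ∃ (d : ℕ) (r : ℕ → R),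
    w = ∑ i ∈ Finset.range d, T i (act v (r i))

namespace LaurentModule

variable {R V : Type*} [NonUnitalRing R] [AddCommGroup V] (D : LaurentModule R V)

/-- `m` does not annihilate the module. -/
def Acts (m : R) : Prop := ∃ u, D.act u m ≠ 0

/-- `w` times the two-sided ideal generated by `m` is in `Z` (for `Z` stable under `R`). -/
def Absorbs (Z : AddSubgroup V) (w : V) (m : R) : Prop :=
  D.act w m ∈ Z ∧ ∀ r, D.act w (r * m) ∈ Z

/-- Every vector is carried into `Z` by an ideal that does not annihilate the module. -/
def Dense (Z : AddSubgroup V) : Prop := ∀ w, ∃ m, D.Acts m ∧ D.Absorbs Z w m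

/-- `v R + v R x + ⋯ + v R x ^ (h - 1)`. -/
def window (h : ℕ) (v : V) : AddSubgroup V where
  carrier := {w | ∃ r : ℕ → R, w = ∑ i ∈ Finset.range h, D.T i (D.act v (r i))}
  zero_mem' := ⟨0, by simp⟩
  add_mem' := by
    rintro _ _ ⟨r, rfl⟩ ⟨s, rfl⟩
    exact ⟨r + s, by simp [Finset.sum_add_distrib]⟩
  neg_mem' := by
    rintro _ ⟨r, rfl⟩
    exact ⟨-r, by simp⟩

variable {D}

theorem mem_window {h : ℕ} {v w : V} :
    w ∈ D.window h v ↔ ∃ r : ℕ → R, w = ∑ i ∈ Finset.range h, D.T i (D.act v (r i)) := Iff.rfl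

theorem T_act_mem_window {h i : ℕ} (hi : i < h) (v : V) (r : R) :
    D.T i (D.act v r) ∈ D.window h v := by
  classical
  refine mem_window.2 ⟨Pi.single i r, ?_⟩
  rw [Finset.sum_eq_single i]
  · simp
  · intro j _ hj
    simp [Pi.single_eq_of_ne hj]
  · intro h'
    exact absurd (Finset.mem_range.2 hi) h'

theorem act_mem_window {h : ℕ} {v w : V} (hw : w ∈ D.window h v) (r : R) :
    D.act w r ∈ D.window h v := by
  obtain ⟨s, rfl⟩ := hw
  exact ⟨fun i => s i * r, by simp [D.T_act, D.act_act, map_sum]⟩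

/-- Every vector is a sum of terms x^i w r, so w R m = 0 would make m annihilate the module. -/
theorem Acts.exists_act_ne_zero {m : R} (hm : D.Acts m) {w : V} (hw : w ≠ 0) :
    ∃ r, D.act w (r * m) ≠ 0 := by
  obtain ⟨u, hu⟩ := hm
  obtain ⟨d, r, rfl⟩ := D.simple w hw u
  by_contra! h
  apply hu
  rw [map_sum, AddMonoidHom.finsetSum_apply]
  refine Finset.sum_eq_zero fun i _ => ?_
  rw [← D.T_act, D.act_act, h, map_zero]

/-- The annihilator of a simple module is prime. Hence finitely many absorption conditions can be
met by one element that acts. -/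
theorem Acts.exists_mul {m m' : R} (hm : D.Acts m) (hm' : D.Acts m') :
    ∃ r, D.Acts (m * (r * m')) := by
  obtain ⟨u, hu⟩ := hm
  obtain ⟨r, hr⟩ := hm'.exists_act_ne_zero hu
  exact ⟨r, u, by rwa [← D.act_act]⟩

theorem Absorbs.mul_right {h : ℕ} {v w : V} {m : R} (hm : D.Absorbs (D.window h v) w m) (r : R) :
    D.Absorbs (D.window h v) w (m * r) := by
  refine ⟨?_, fun s => ?_⟩
  · rw [← D.act_act]
    exact act_mem_window hm.1 r
  · rw [← mul_assoc, ← D.act_act]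
    exact act_mem_window (hm.2 s) r

theorem Absorbs.mul_left {Z : AddSubgroup V} {w : V} {m : R} (hm : D.Absorbs Z w m) (r : R) :
    D.Absorbs Z w (r * m) :=
  ⟨hm.2 r, fun s => by rw [← mul_assoc]; exact hm.2 _⟩

theorem exists_common_absorbs {h : ℕ} {v : V} (w : ℕ → V)
    (hw : ∀ i, ∃ m, D.Acts m ∧ D.Absorbs (D.window h v) (w i) m) (d : ℕ) :
    ∃ m, D.Acts m ∧ ∀ i ≤ d, D.Absorbs (D.window h v) (w i) m := by
  induction d with
  | zero =>
    obtain ⟨m, hm, hm'⟩ := hw 0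
    exact ⟨m, hm, fun i hi => by rwa [Nat.le_zero.1 hi]⟩
  | succ d ih =>
    obtain ⟨m, hm, hm'⟩ := ih
    obtain ⟨p, hp, hp'⟩ := hw (d + 1)
    obtain ⟨r, hr⟩ := hm.exists_mul hp
    refine ⟨_, hr, fun i hi => ?_⟩
    rcases Nat.of_le_succ hi with hi | rfl
    · exact (hm' i hi).mul_right _
    · exact (hp'.mul_left _).mul_left _

/-- An algebraic relation for `x` bounds the number of translates of `v R` that are needed. -/
theorem dense_window_of_relation {n : ℕ} {a : R} (ha : D.Acts a) (c : ℕ → R)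
    (hc : ∀ u, D.T n (D.act u a) = ∑ i ∈ Finset.range n, D.T i (D.act u (c i)))
    {v : V} (hv : v ≠ 0) : D.Dense (D.window n v) := by
  have hn : 0 < n := by
    rcases Nat.eq_zero_or_pos n with rfl | h
    · obtain ⟨u, hu⟩ := ha
      have := hc u
      simp only [Nat.cast_zero, D.T_zero, Finset.range_zero, Finset.sum_empty] at this
      exact absurd this hu
    · exact h
  -- Only the top term can leave the window after multiplication by x, and the relation rewrites it.
  have shift : ∀ z ∈ D.window n v, D.act (D.T 1 z) a ∈ D.window n v := by
    rintro _ ⟨r, rfl⟩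
    rw [map_sum, map_sum, AddMonoidHom.finsetSum_apply]
    refine AddSubgroup.sum_mem _ fun i hi => ?_
    rw [← D.T_add, ← D.T_act, D.act_act]
    have e : (1 : ℤ) + i = ((i + 1 : ℕ) : ℤ) := by push_cast; ring
    rw [e]
    rcases Nat.lt_or_ge (i + 1) n with h | h
    · exact T_act_mem_window h _ _
    · have : i + 1 = n := le_antisymm (Finset.mem_range.1 hi) h
      rw [this, ← D.act_act, hc]
      exact AddSubgroup.sum_mem _ fun j hj => by
        rw [D.act_act]; exact T_act_mem_window (Finset.mem_range.1 hj) _ _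
  have key : ∀ i : ℕ, ∃ m, D.Acts m ∧ D.Absorbs (D.window n v) (D.T i v) m := by
    intro i
    induction i with
    | zero =>
      refine ⟨a, ha, ?_, fun r => ?_⟩ <;> rw [← D.T_act] <;> exact T_act_mem_window hn _ _
    | succ i ih =>
      obtain ⟨m, hm, hm'⟩ := ih
      obtain ⟨r, hr⟩ := hm.exists_mul ha
      have e : ((i + 1 : ℕ) : ℤ) = 1 + i := by push_cast; ring
      refine ⟨_, hr, ?_, fun s => ?_⟩
      · rw [e, D.T_add, ← mul_assoc, ← D.act_act, ← D.T_act]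
        exact shift _ (hm'.mul_right r).1
      · rw [e, D.T_add, ← mul_assoc m, ← mul_assoc s, ← D.act_act, ← D.T_act]
        exact shift _ ((hm'.mul_right r).2 s)
  intro w
  obtain ⟨d, r, rfl⟩ := D.simple v hv w
  obtain ⟨m, hm, hm'⟩ := exists_common_absorbs (fun i => D.T i v) key d
  refine ⟨m, hm, ?_, fun s => ?_⟩ <;>
    rw [map_sum, AddMonoidHom.finsetSum_apply] <;>
    refine AddSubgroup.sum_mem _ fun i hi => ?_ <;>
    rw [D.T_act, D.act_act]
  · exact (hm' i (Finset.mem_range.1 hi).le).2 _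
  · rw [← mul_assoc]
    exact (hm' i (Finset.mem_range.1 hi).le).2 _

theorem Dense.mono {Y Z : AddSubgroup V} (h : Y ≤ Z) (hY : D.Dense Y) : D.Dense Z := fun w => by
  obtain ⟨m, hm, h1, h2⟩ := hY w
  exact ⟨m, hm, h h1, fun r => h (h2 r)⟩

/-- If the shorter window is not dense, the sum of the translates is direct. -/
theorem act_eq_zero_of_sum_eq_zero {h : ℕ} (hd : ∀ y, y ≠ 0 → D.Dense (D.window (h + 1) y))
    {v : V} (hv : ¬ D.Dense (D.window h v)) (r : ℕ → R)
    (hr : ∑ i ∈ Finset.range (h + 1), D.T i (D.act v (r i)) = 0) :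
    ∀ i < h + 1, D.act v (r i) = 0 := by
  classical
  by_contra! hne
  let s := (Finset.range (h + 1)).filter fun i => D.act v (r i) ≠ 0
  have hs : s.Nonempty := by
    obtain ⟨i, hi, hi'⟩ := hne
    exact ⟨i, Finset.mem_filter.2 ⟨Finset.mem_range.2 hi, hi'⟩⟩
  obtain ⟨j, hj, hmax⟩ := s.exists_max_image id hs
  simp only [id] at hmax
  have hjh : j < h + 1 := Finset.mem_range.1 (Finset.mem_filter.1 hj).1
  have hy : D.act v (r j) ≠ 0 := (Finset.mem_filter.1 hj).2
  have htop : D.T j (D.act v (r j)) = -∑ i ∈ Finset.range j, D.T i (D.act v (r i)) := by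
    rw [eq_neg_iff_add_eq_zero, add_comm, ← Finset.sum_range_succ, ← hr]
    refine Finset.sum_subset (Finset.range_mono (by omega)) fun i hi hi' => ?_
    by_contra h0
    have : D.act v (r i) ≠ 0 := fun h1 => h0 (by rw [h1, map_zero])
    have := hmax i (Finset.mem_filter.2 ⟨hi, this⟩)
    simp only [Finset.mem_range] at hi'
    omega
  -- With y = v r_j, the window of length h + 1 on y lies in the window of length h on v: only x^h y
  -- c needs rewriting, through x^h = x^(h-j) x^j and `htop`.
  refine hv ((hd _ hy).mono ?_)
  rintro _ ⟨c, rfl⟩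
  refine AddSubgroup.sum_mem _ fun i hi => ?_
  rw [D.act_act]
  rcases Nat.lt_or_ge i h with h1 | h1
  · exact T_act_mem_window h1 _ _
  · have hi' : i = h := by have := Finset.mem_range.1 hi; omega
    subst hi'
    have e : (i : ℤ) = ((i - j : ℕ) : ℤ) + j := by
      rw [← Nat.cast_add]; congr 1; omega
    rw [e, D.T_add, ← D.act_act, D.T_act, htop, D.T_act]
    refine act_mem_window ?_ _
    rw [map_neg]
    refine AddSubgroup.neg_mem _ ?_
    rw [map_sum]
    refine AddSubgroup.sum_mem _ fun l hl => ?_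
    rw [← D.T_add, ← Nat.cast_add]
    exact T_act_mem_window (by have := Finset.mem_range.1 hl; omega) _ _

theorem act_eq_act_of_sum_eq_sum {h : ℕ} (hd : ∀ y, y ≠ 0 → D.Dense (D.window (h + 1) y))
    {v : V} (hv : ¬ D.Dense (D.window h v)) (r s : ℕ → R)
    (hr : ∑ i ∈ Finset.range (h + 1), D.T i (D.act v (r i)) =
      ∑ i ∈ Finset.range (h + 1), D.T i (D.act v (s i))) {i : ℕ} (hi : i < h + 1) :
    D.act v (r i) = D.act v (s i) := by
  rw [← sub_eq_zero, ← map_sub]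
  refine act_eq_zero_of_sum_eq_zero hd hv (fun i => r i - s i) ?_ i hi
  simp only [map_sub, Finset.sum_sub_distrib, hr, sub_self]

/-- No translate of `v` is in the window. -/
theorem T_notMem_window (hR : IsNilRing R) {h : ℕ}
    (hd : ∀ y, y ≠ 0 → D.Dense (D.window (h + 1) y)) {v : V} (hv0 : v ≠ 0)
    (hv : ¬ D.Dense (D.window h v)) (e : ℤ) : D.T e v ∉ D.window (h + 1) v := by
  rintro ⟨r, hr⟩
  have hcomp : ∀ q, D.T e (D.act v q) =
      ∑ i ∈ Finset.range (h + 1), D.T i (D.act v (r i * q)) := fun q => by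
    rw [D.T_act, hr, map_sum, AddMonoidHom.finsetSum_apply]
    simp only [D.T_act, D.act_act]
  have hzero : ∀ i < h + 1, D.act v (r i) = 0 := by
    intro i hi
    by_contra hri
    -- A power of r_i serves as p: otherwise no power of r_i could annihilate v.
    obtain ⟨p, hp, hp'⟩ : ∃ p, D.act v p ≠ 0 ∧ D.act v (r i * p) = 0 := by
      have hcomm : ∀ k, r i * rngPow (r i) k = rngPow (r i) (k + 1) := by
        intro k
        induction k with
        | zero => rfl
        | succ k ih => rw [rngPow, ← mul_assoc, ih]; rfl
      by_contra! hcon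
      have hall : ∀ k, D.act v (rngPow (r i) k) ≠ 0 := by
        intro k
        induction k with
        | zero => exact hri
        | succ k ih => rw [← hcomm]; exact hcon _ ih
      obtain ⟨k, hk⟩ := hR (r i)
      exact hall k (by rw [hk, map_zero])
    obtain ⟨m, hm, hm'⟩ := hd _ hp v
    obtain ⟨q, hq⟩ := hm.exists_act_ne_zero hri
    obtain ⟨x, hx⟩ := hm'.2 q
    -- The vector v q m is in vR and in the window on v p, so independence leaves only the constant
    -- term.
    have h0 : D.act v (q * m) = D.act v (p * x 0) := by
      have := act_eq_act_of_sum_eq_sum hd hv (fun i => if i = 0 then q * m else 0)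
        (fun i => p * x i) ?_ (Nat.succ_pos h)
      · simpa using this
      · simp only [D.act_act] at hx
        rw [← hx, Finset.sum_eq_single 0]
        · simp [D.T_zero]
        · intro j _ hj; simp [hj]
        · simp
    -- Equal vectors have equal expansions after applying x^e; the i-th terms give v r_i q m = v r_i
    -- p x_0 = 0.
    have h1 := act_eq_act_of_sum_eq_sum hd hv (fun i => r i * (q * m))
      (fun i => r i * (p * x 0)) (by rw [← hcomp, ← hcomp, h0]) hi
    apply hq
    rw [D.act_act, h1, ← mul_assoc, ← D.act_act, hp', map_zero, AddMonoidHom.zero_apply]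
  have : D.T e v = 0 := by
    rw [hr]
    refine Finset.sum_eq_zero fun i hi => ?_
    rw [hzero i (Finset.mem_range.1 hi), map_zero]
  apply hv0
  rw [← D.T_zero v, ← neg_add_cancel e, D.T_add, this, map_zero]

/-- The successive action of the elements of a list. -/
def actList (D : LaurentModule R V) (v : V) (l : List R) : V := l.foldl (fun w m => D.act w m) v

theorem actList_T (j : ℤ) (v : V) (l : List R) : D.actList (D.T j v) l = D.T j (D.actList v l) := by
  induction l generalizing v with
  | nil => rfl
  | cons m l ih =>
    simp only [actList, List.foldl_cons] at ih ⊢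
    rw [← D.T_act, ih]

theorem actList_sum {ι : Type*} (s : Finset ι) (v : ι → V) (l : List R) :
    D.actList (∑ i ∈ s, v i) l = ∑ i ∈ s, D.actList (v i) l := by
  induction l generalizing v with
  | nil => rfl
  | cons m l ih =>
    simp only [actList, List.foldl_cons] at ih ⊢
    rw [map_sum, AddMonoidHom.finsetSum_apply, ih]

/-- Each factor of the list pays for one unit of shift, in either direction. -/
theorem T_actList_mem {Z : AddSubgroup V} {l : List R}
    (h0 : ∀ m ∈ l, ∀ z ∈ Z, D.act z m ∈ Z) (h1 : ∀ m ∈ l, ∀ z ∈ Z, D.act (D.T 1 z) m ∈ Z)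
    (h2 : ∀ m ∈ l, ∀ z ∈ Z, D.act (D.T (-1) z) m ∈ Z) {z : V} (hz : z ∈ Z) {j : ℤ}
    (hj : |j| ≤ l.length) : D.T j (D.actList z l) ∈ Z := by
  induction l generalizing z j with
  | nil =>
    have : j = 0 := by simpa using hj
    rw [this, D.T_zero]
    exact hz
  | cons m l ih =>
    simp only [List.forall_mem_cons] at h0 h1 h2
    have ih' := fun {z} hz {j} hj => @ih h0.2 h1.2 h2.2 z hz j hj
    change D.T j (D.actList (D.act z m) l) ∈ Z
    rw [List.length_cons, Nat.cast_add, Nat.cast_one] at hj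
    rw [abs_le] at hj
    by_cases hlt : |j| ≤ l.length
    · exact ih' (h0.1 z hz) hlt
    · rw [abs_le, not_and_or] at hlt
      rcases le_total 0 j with hj0 | hj0
      · have e : j = (j - 1) + 1 := by ring
        rw [e, D.T_add, ← actList_T, D.T_act]
        exact ih' (h1.1 z hz) (abs_le.2 ⟨by omega, by omega⟩)
      · have e : j = (j + 1) + -1 := by ring
        rw [e, D.T_add, ← actList_T, D.T_act]
        exact ih' (h2.1 z hz) (abs_le.2 ⟨by omega, by omega⟩)

/-- If `v` is fixed by a polynomial with coefficients in an ideal carrying the neighbouring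
translates of the window back into the window, then some translate of `v` is in the window. -/
theorem exists_T_mem_window {h : ℕ} (hd : ∀ y, y ≠ 0 → D.Dense (D.window (h + 1) y))
    {v : V} (hv : v ≠ 0) : ∃ e : ℤ, D.T e v ∈ D.window (h + 1) v := by
  -- The exponents h + 1 and -1 are the two positions adjacent to the window.
  obtain ⟨m, hm, hm1, hm2⟩ : ∃ m, D.Acts m ∧ D.Absorbs (D.window (h + 1) v) (D.T (h + 1) v) m ∧
      D.Absorbs (D.window (h + 1) v) (D.T (-1) v) m := by
    obtain ⟨a, ha, ha'⟩ := hd v hv (D.T (h + 1) v)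
    obtain ⟨b, hb, hb'⟩ := hd v hv (D.T (-1) v)
    obtain ⟨r, hr⟩ := ha.exists_mul hb
    exact ⟨_, hr, ha'.mul_right _, (hb'.mul_left _).mul_left _⟩
  obtain ⟨q, hq⟩ := hm.exists_act_ne_zero hv
  obtain ⟨d, c, hc⟩ := D.simple _ hq v
  set Z := D.window (h + 1) v with hZ
  let p : ℕ → R := fun i => q * m * c i
  have hp : v = ∑ i ∈ Finset.range d, D.T i (D.act v (p i)) := by
    simpa only [D.act_act] using hc
  have hp1 : ∀ i r, D.act (D.T (h + 1) v) (r * p i) ∈ Z := fun i r =>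
    ((hm1.mul_left q).mul_right (c i)).2 r
  have hp2 : ∀ i r, D.act (D.T (-1) v) (r * p i) ∈ Z := fun i r =>
    ((hm2.mul_left q).mul_right (c i)).2 r
  have shift1 : ∀ i, ∀ z ∈ Z, D.act (D.T 1 z) (p i) ∈ Z := by
    rintro i _ ⟨r, rfl⟩
    rw [map_sum, map_sum, AddMonoidHom.finsetSum_apply]
    refine AddSubgroup.sum_mem _ fun j hj => ?_
    rw [← D.T_add, ← D.T_act, D.act_act]
    rcases Nat.lt_or_ge (j + 1) (h + 1) with h' | h'
    · rw [show (1 : ℤ) + j = ((j + 1 : ℕ) : ℤ) by push_cast; ring]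
      exact T_act_mem_window h' _ _
    · have : (j : ℤ) = h := by have := Finset.mem_range.1 hj; omega
      rw [this, D.T_act, add_comm]
      exact hp1 _ _
  have shift2 : ∀ i, ∀ z ∈ Z, D.act (D.T (-1) z) (p i) ∈ Z := by
    rintro i _ ⟨r, rfl⟩
    rw [map_sum, map_sum, AddMonoidHom.finsetSum_apply]
    refine AddSubgroup.sum_mem _ fun j hj => ?_
    rw [← D.T_add, ← D.T_act, D.act_act]
    rcases Nat.eq_zero_or_pos j with rfl | h'
    · rw [D.T_act]
      exact hp2 _ _
    · rw [show (-1 : ℤ) + j = ((j - 1 : ℕ) : ℤ) by omega]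
      exact T_act_mem_window (by have := Finset.mem_range.1 hj; omega) _ _
  have near : ∀ l : List R, l ≠ [] → (∀ x ∈ l, ∃ i, x = p i) → ∀ j : ℤ, |j| ≤ l.length - 1 →
      D.T j (D.actList v l) ∈ Z := by
    intro l hl hlp j hj
    obtain ⟨a, l, rfl⟩ := List.exists_cons_of_ne_nil hl
    have hlp' : ∀ x ∈ l, ∃ i, x = p i := fun x hx => hlp x (List.mem_cons_of_mem _ hx)
    have hav : D.act v a ∈ Z := by
      rw [← D.T_zero (D.act v a)]
      exact T_act_mem_window (i := 0) (Nat.succ_pos h) _ _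
    refine T_actList_mem (l := l) ?_ ?_ ?_ hav (by simpa using hj)
    · intro x _ z hz
      exact act_mem_window hz x
    · intro x hx z hz
      obtain ⟨i, rfl⟩ := hlp' x hx
      exact shift1 i z hz
    · intro x hx z hz
      obtain ⟨i, rfl⟩ := hlp' x hx
      exact shift2 i z hz
  -- Expanding v lengthens the list by one and raises the exponent by less than d.
  have prepend : ∀ l, D.actList v l = ∑ i ∈ Finset.range d, D.T i (D.actList v (p i :: l)) := by
    intro l
    conv_lhs => rw [hp]
    rw [actList_sum]
    exact Finset.sum_congr rfl fun i _ => actList_T _ _ _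
  -- For lists longer than d the lower bound on j can be dropped: when j is too negative for `near`,
  -- prepending raises it by less than d, which cannot overshoot the upper bound, and the added
  -- factor extends the lower bound.
  have far : ∀ (N : ℕ) (l : List R), d + 1 ≤ l.length → (∀ x ∈ l, ∃ i, x = p i) → ∀ j : ℤ,
      j ≤ l.length - 1 → -j ≤ l.length - 1 + N → D.T j (D.actList v l) ∈ Z := by
    intro N
    induction N with
    | zero =>
      intro l hl hlp j hj hj'
      refine near l (fun h0 => by simp [h0] at hl) hlp j (abs_le.2 ⟨by push_cast at hj'; linarith, hj⟩)
    | succ N ih =>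
      intro l hl hlp j hj hj'
      by_cases hcase : -j ≤ l.length - 1 + N
      · exact ih l hl hlp j hj hcase
      rw [prepend, map_sum]
      refine AddSubgroup.sum_mem _ fun i hi => ?_
      have hid := Finset.mem_range.1 hi
      rw [← D.T_add]
      refine ih _ (by simp; omega) ?_ _ ?_ ?_
      · intro x hx
        rcases List.mem_cons.1 hx with rfl | hx
        · exact ⟨i, rfl⟩
        · exact hlp x hx
      · simp only [List.length_cons]
        push_cast
        omega
      · simp only [List.length_cons]
        push_cast at hj' ⊢
        omega
  -- Starting at or below -(k d) leaves room for k expansions, after which the list is long enough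
  -- for `far`.
  have start : ∀ k : ℕ, ∀ l : List R, (∀ x ∈ l, ∃ i, x = p i) → d + 1 ≤ k + l.length →
      ∀ j : ℤ, j ≤ -(k * d : ℕ) → D.T j (D.actList v l) ∈ Z := by
    intro k
    induction k with
    | zero =>
      intro l hlp hl j hj
      refine far j.natAbs l (by omega) hlp j ?_ ?_ <;> simp at hj <;> omega
    | succ k ih =>
      intro l hlp hl j hj
      rw [prepend, map_sum]
      refine AddSubgroup.sum_mem _ fun i hi => ?_
      have hid := Finset.mem_range.1 hi
      rw [← D.T_add]
      refine ih _ ?_ (by simp; omega) _ ?_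
      · intro x hx
        rcases List.mem_cons.1 hx with rfl | hx
        · exact ⟨i, rfl⟩
        · exact hlp x hx
      · have : ((k + 1) * d : ℕ) = k * d + d := by ring
        rw [this] at hj
        push_cast at hj ⊢
        omega
  exact ⟨_, start (d + 1) [] (by simp) (by simp) _ le_rfl⟩

/-- Over a nil ring the indeterminate satisfies no algebraic relation on a simple module. -/
theorem not_relation (hR : IsNilRing R) {n : ℕ} {a : R} (ha : D.Acts a) (c : ℕ → R)
    (hc : ∀ u, D.T n (D.act u a) = ∑ i ∈ Finset.range n, D.T i (D.act u (c i))) : False := by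
  classical
  have hex : ∃ h, ∀ y, y ≠ 0 → D.Dense (D.window h y) :=
    ⟨n, fun y hy => dense_window_of_relation ha c hc hy⟩
  obtain ⟨u, hu⟩ := ha
  cases hfind : Nat.find hex with
  | zero =>
    have h0 := Nat.find_spec hex
    rw [hfind] at h0
    obtain ⟨m, hm, hm'⟩ := h0 _ hu (D.act u a)
    obtain ⟨r, hr⟩ := hm.exists_act_ne_zero hu
    obtain ⟨s, hs⟩ := hm'.2 r
    exact hr (by simpa using hs)
  | succ h =>
    have hd := Nat.find_spec hex
    rw [hfind] at hd
    have hmin : ¬ ∀ y, y ≠ 0 → D.Dense (D.window h y) := Nat.find_min hex (by omega)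
    push Not at hmin
    obtain ⟨v, hv0, hv⟩ := hmin
    obtain ⟨e, he⟩ := exists_T_mem_window hd hv0
    exact T_notMem_window hR hd hv0 hv e he

end LaurentModule

theorem AddMonoid.End.mul_apply {V : Type*} [AddCommMonoid V] (f g : AddMonoid.End V) (v : V) :
    (f * g) v = f (g v) := rfl

/-! ### Invertibility of x and annihilating polynomials -/

namespace LaurentModule

variable {R V : Type*} [NonUnitalRing R] [AddCommGroup V]

/-- On a simple module over `R[x]`, with `R` nil, the indeterminate acts invertibly. -/
theorem exists_of_simple (hR : IsNilRing R) [Nontrivial V] (act : V →+ R →+ V)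
    (act_act : ∀ v r s, act (act v r) s = act v (r * s)) (x : AddMonoid.End V)
    (x_act : ∀ v r, x (act v r) = act (x v) r)
    (simple : ∀ v, v ≠ 0 → ∀ w, ∃ (d : ℕ) (r : ℕ → R),
      w = ∑ i ∈ Finset.range d, (x ^ i) (act v (r i))) :
    ∃ D : LaurentModule R V, D.act = act ∧ ∀ (i : ℕ) (v : V), D.T i v = (x ^ i) v := by
  have act_fixed : ∀ v r, v = act v r → v = 0 := by
    intro v r h
    have key : ∀ k, v = act v (rngPow r k) := by
      intro k
      induction k with
      | zero => exact h
      | succ k ih => rw [rngPow, ← act_act, ← ih]; exact h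
    obtain ⟨k, hk⟩ := hR r
    rw [key k, hk, map_zero]
  -- If x v = 0, an expansion of v in terms of itself keeps only its constant term: v = v r with r
  -- nilpotent.
  have hinj : Function.Injective x := by
    rw [injective_iff_map_eq_zero]
    intro v hv
    by_contra hv0
    obtain ⟨d, r, h⟩ := simple v hv0 v
    have hterm : ∀ i, i ≠ 0 → (x ^ i) (act v (r i)) = 0 := by
      intro i hi
      obtain ⟨j, rfl⟩ := Nat.exists_eq_succ_of_ne_zero hi
      rw [pow_succ, AddMonoid.End.mul_apply, x_act, hv, map_zero, AddMonoidHom.zero_apply, map_zero]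
    rcases Nat.eq_zero_or_pos d with rfl | hd
    · exact hv0 (by simpa using h)
    · rw [Finset.sum_eq_single 0 (fun i _ hi => hterm i hi)
        (fun h' => absurd (Finset.mem_range.2 hd) h')] at h
      exact hv0 (act_fixed v (r 0) h)
  -- By simplicity, any w lies in (x v) R[x] = x (v R[x]).
  have hsurj : Function.Surjective x := by
    intro w
    obtain ⟨v, hv⟩ := exists_ne (0 : V)
    have hxv : x v ≠ 0 := fun h => hv (hinj (by rw [h, map_zero]))
    obtain ⟨d, r, rfl⟩ := simple _ hxv w
    refine ⟨∑ i ∈ Finset.range d, (x ^ i) (act v (r i)), ?_⟩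
    rw [map_sum]
    refine Finset.sum_congr rfl fun i _ => ?_
    rw [← x_act, ← AddMonoid.End.mul_apply, ← AddMonoid.End.mul_apply, ← pow_succ, ← pow_succ']
  let e : V ≃+ V := AddEquiv.ofBijective x ⟨hinj, hsurj⟩
  let t : (AddMonoid.End V)ˣ :=
    ⟨x, e.symm.toAddMonoidHom, by ext v; exact e.apply_symm_apply v,
      by ext v; exact e.symm_apply_apply v⟩
  have inv_act : ∀ v r, (↑t⁻¹ : AddMonoid.End V) (act v r) = act ((↑t⁻¹ : AddMonoid.End V) v) r := by
    intro v r
    apply hinj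
    rw [x_act]
    exact (e.apply_symm_apply _).trans (congrArg (fun w => act w r) (e.apply_symm_apply v).symm)
  refine ⟨⟨act, fun j => ((t ^ j : (AddMonoid.End V)ˣ) : AddMonoid.End V), act_act, ?_, ?_, ?_, ?_⟩,
    rfl, ?_⟩
  · intro v; rfl
  · intro i j v; rw [zpow_add, Units.val_mul, AddMonoid.End.mul_apply]
  · intro j v r
    induction j using Int.induction_on with
    | zero => rfl
    | succ i ih =>
      rw [add_comm, zpow_add, zpow_one, Units.val_mul, AddMonoid.End.mul_apply, ih,
        AddMonoid.End.mul_apply]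
      exact x_act _ _
    | pred i ih =>
      rw [sub_eq_add_neg, add_comm, zpow_add, zpow_neg_one, Units.val_mul,
        AddMonoid.End.mul_apply, ih, AddMonoid.End.mul_apply]
      exact inv_act _ _
  · intro v hv w
    obtain ⟨d, r, h⟩ := simple v hv w
    refine ⟨d, r, h.trans (Finset.sum_congr rfl fun i _ => ?_)⟩
    rw [zpow_natCast, Units.val_pow_eq_pow_val]
  · intro i v
    change ((t ^ (i : ℤ) : (AddMonoid.End V)ˣ) : AddMonoid.End V) v = _
    rw [zpow_natCast, Units.val_pow_eq_pow_val]

/-- A polynomial that annihilates a simple `R[x]`-module, with `R` nil, has coefficients that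
annihilate it. -/
theorem coeff_annihilates (hR : IsNilRing R) (D : LaurentModule R V) (c : ℕ → R) (d : ℕ)
    (hc : ∀ v, ∑ i ∈ Finset.range d, D.T i (D.act v (c i)) = 0) :
    ∀ i < d, ∀ v, D.act v (c i) = 0 := by
  classical
  by_contra! hne
  let s := (Finset.range d).filter fun i => D.Acts (c i)
  have hs : s.Nonempty := by
    obtain ⟨i, hi, v, hv⟩ := hne
    exact ⟨i, Finset.mem_filter.2 ⟨Finset.mem_range.2 hi, v, hv⟩⟩
  obtain ⟨n, hn, hmax⟩ := s.exists_max_image id hs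
  simp only [id] at hmax
  have hnd : n < d := Finset.mem_range.1 (Finset.mem_filter.1 hn).1
  -- The terms beyond n vanish by maximality, so x^n is expressed by lower powers.
  refine not_relation hR (n := n) (Finset.mem_filter.1 hn).2 (fun i => -c i) fun u => ?_
  simp only [map_neg, Finset.sum_neg_distrib]
  rw [eq_neg_iff_add_eq_zero, add_comm, ← Finset.sum_range_succ (fun i => D.T i (D.act u (c i))),
    ← hc u]
  refine Finset.sum_subset (Finset.range_mono (by omega)) fun i hi hi' => ?_
  by_contra h0
  have hact : D.Acts (c i) := ⟨u, fun h1 => h0 (by rw [h1, map_zero])⟩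
  have := hmax i (Finset.mem_filter.2 ⟨hi, hact⟩)
  simp only [Finset.mem_range] at hi'
  omega

end LaurentModule

/-! ### Coefficients and the shift on R[x] -/

namespace RngPoly

variable {R : Type*} [NonUnitalRing R]

theorem coeff_monomial (n m : ℕ) (a : R) : coeff (monomial n a) m = if n = m then a else 0 :=
  Finsupp.single_apply

theorem coeff_add (f g : RngPoly R) (n : ℕ) : coeff (f + g) n = coeff f n + coeff g n := rfl

theorem coeff_zero (n : ℕ) : coeff (0 : RngPoly R) n = 0 := rfl

theorem ext {f g : RngPoly R} (h : ∀ n, coeff f n = coeff g n) : f = g := Finsupp.ext h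

/-- An additive map out of `R[x]` given by its values on the monomials. -/
noncomputable def lift {M : Type*} [AddCommMonoid M] (φ : ℕ → R →+ M) : RngPoly R →+ M :=
  Finsupp.liftAddHom φ

theorem lift_monomial {M : Type*} [AddCommMonoid M] (φ : ℕ → R →+ M) (n : ℕ) (a : R) :
    lift φ (monomial n a) = φ n a :=
  Finsupp.liftAddHom_apply_single φ n a

theorem eq_sum_monomial (f : RngPoly R) :
    ∃ d, f = ∑ i ∈ Finset.range d, monomial i (coeff f i) := by
  have hsum : ∀ (d : ℕ) (n : ℕ), coeff (∑ i ∈ Finset.range d, monomial i (coeff f i)) n =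
      if n < d then coeff f n else 0 := by
    intro d n
    induction d with
    | zero => rfl
    | succ d ih =>
      rw [Finset.sum_range_succ, coeff_add, ih, coeff_monomial]
      rcases lt_trichotomy n d with h | rfl | h
      · simp [h, h.ne', Nat.lt_succ_of_lt h]
      · simp
      · simp [h.ne, h.not_gt, show ¬ n < d + 1 by omega]
  obtain ⟨d, hd⟩ : ∃ d, ∀ n, d ≤ n → coeff f n = 0 := by
    refine ⟨(Finsupp.support f).sup id + 1, fun n hn => ?_⟩
    by_contra h
    have : n ≤ (Finsupp.support f).sup id :=
      Finset.le_sup (f := id) (Finsupp.mem_support_iff.2 h)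
    omega
  refine ⟨d, ext fun n => ?_⟩
  rw [hsum]
  split_ifs with h
  · rfl
  · exact hd n (not_lt.1 h)

/-- Multiplication by the indeterminate. -/
noncomputable def shift : AddMonoid.End (RngPoly R) := lift fun n => monomial (n + 1)

theorem shift_monomial (n : ℕ) (a : R) : shift (monomial n a) = monomial (n + 1) a :=
  lift_monomial _ _ _

theorem shift_mul (f g : RngPoly R) : shift (f * g) = shift f * g := by
  induction f using induction_on with
  | zero => simp
  | add f f' hf hf' => simp only [add_mul, map_add, hf, hf']
  | mono i a =>
    induction g using induction_on with
    | zero => simp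
    | add g g' hg hg' => simp only [mul_add, map_add, hg, hg']
    | mono j b => simp only [monomial_mul_monomial, shift_monomial, Nat.add_right_comm]

theorem mul_shift (f g : RngPoly R) : f * shift g = shift (f * g) := by
  induction f using induction_on with
  | zero => simp
  | add f f' hf hf' => simp only [add_mul, map_add, hf, hf']
  | mono i a =>
    induction g using induction_on with
    | zero => simp
    | add g g' hg hg' => simp only [mul_add, map_add, hg, hg']
    | mono j b => simp only [monomial_mul_monomial, shift_monomial, Nat.add_assoc]

theorem shift_pow_monomial (n m : ℕ) (a : R) :
    (shift ^ n) (monomial m a) = monomial (m + n) a := by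
  induction n with
  | zero => rfl
  | succ n ih => rw [pow_succ', AddMonoid.End.mul_apply, ih, shift_monomial, Nat.add_assoc]

theorem mul_shift_pow (f g : RngPoly R) (n : ℕ) : f * (shift ^ n) g = (shift ^ n) (f * g) := by
  induction n with
  | zero => rfl
  | succ n ih =>
    simp only [pow_succ', AddMonoid.End.mul_apply]
    rw [mul_shift, ih]

theorem mul_monomial (f : RngPoly R) (n : ℕ) (a : R) :
    f * monomial n a = (shift ^ n) (f * monomial 0 a) := by
  rw [← mul_shift_pow, shift_pow_monomial, zero_add]

end RngPoly

/-! ### Modular maximal right ideals -/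

section Modular

variable {S : Type*} [NonUnitalRing S]

/-- A modular maximal right ideal `Q` contains every `w` with `w S ⊆ Q`. -/
theorem mem_of_forall_mul_mem {Q : AddSubgroup S} (hmax : IsMaximalRightIdeal Q)
    (hmod : IsModularRightIdeal Q) {w : S} (hw : ∀ a, w * a ∈ Q) : w ∈ Q := by
  let Q' : AddSubgroup S :=
    { carrier := {w | ∀ a, w * a ∈ Q}
      zero_mem' := fun a => by rw [zero_mul]; exact Q.zero_mem
      add_mem' := fun hx hy a => by rw [add_mul]; exact Q.add_mem (hx a) (hy a)
      neg_mem' := fun hx a => by rw [neg_mul]; exact Q.neg_mem (hx a) }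
  have hQ' : IsRightIdeal Q' := fun q hq r a => by rw [mul_assoc]; exact hq _
  have hle : Q ≤ Q' := fun q hq a => hmax.prop.1 q hq a
  obtain ⟨b, hb⟩ := hmod.2
  have hne : Q' ≠ ⊤ := by
    intro h
    refine hmax.prop.2 (eq_top_iff.2 fun a _ => ?_)
    have h1 : b ∈ Q' := h ▸ AddSubgroup.mem_top b
    have := Q.add_mem (hb a) (h1 a)
    rwa [sub_add_cancel] at this
  exact hmax.le_of_ge ⟨hQ', hne⟩ hle hw

/-- This is the simplicity of S/Q: if v S + Q were proper it would equal Q, forcing v S ⊆ Q and then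
v ∈ Q. -/
theorem exists_sub_mul_mem {Q : AddSubgroup S} (hmax : IsMaximalRightIdeal Q)
    (hmod : IsModularRightIdeal Q) {v : S} (hv : v ∉ Q) (w : S) : ∃ g, w - v * g ∈ Q := by
  let Q' : AddSubgroup S :=
    { carrier := {w | ∃ g, w - v * g ∈ Q}
      zero_mem' := ⟨0, by simp⟩
      add_mem' := by
        rintro x y ⟨g, hg⟩ ⟨g', hg'⟩
        refine ⟨g + g', ?_⟩
        have := Q.add_mem hg hg'
        rwa [← add_sub_add_comm, ← mul_add] at this
      neg_mem' := by
        rintro x ⟨g, hg⟩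
        refine ⟨-g, ?_⟩
        have := Q.neg_mem hg
        rwa [neg_sub', ← mul_neg] at this }
  have hQ' : IsRightIdeal Q' := by
    rintro x ⟨g, hg⟩ r
    refine ⟨g * r, ?_⟩
    have := hmax.prop.1 _ hg r
    rwa [sub_mul, mul_assoc] at this
  have hle : Q ≤ Q' := fun q hq => ⟨0, by simpa using hq⟩
  by_cases htop : Q' = ⊤
  · exact (htop ▸ AddSubgroup.mem_top w : w ∈ Q')
  · exfalso
    refine hv (mem_of_forall_mul_mem hmax hmod fun a => ?_)
    exact hmax.le_of_ge ⟨hQ', htop⟩ hle ⟨a, by simp⟩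

/-- An element `g` that is not of the form `a - g a` is outside a modular maximal right ideal for
which it is a left identity. -/
theorem exists_maximal_modular (g : S) (hg : ∀ a, g ≠ a - g * a) :
    ∃ Q : AddSubgroup S, IsMaximalRightIdeal Q ∧ IsModularRightIdeal Q := by
  let Q₀ : AddSubgroup S :=
    { carrier := {w | ∃ a, w = a - g * a}
      zero_mem' := ⟨0, by simp⟩
      add_mem' := by
        rintro _ _ ⟨a, rfl⟩ ⟨b, rfl⟩
        exact ⟨a + b, by rw [mul_add]; abel⟩
      neg_mem' := by
        rintro _ ⟨a, rfl⟩
        exact ⟨-a, by rw [mul_neg]; abel⟩ }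
  have hQ₀ : IsRightIdeal Q₀ := by
    rintro _ ⟨a, rfl⟩ r
    exact ⟨a * r, by rw [sub_mul, mul_assoc]⟩
  -- A right ideal containing Q₀ is proper exactly when it omits g, since a = (a - g a) + g a;
  -- omitting g survives unions of chains.
  obtain ⟨Q, hle, hQ⟩ := zorn_le_nonempty₀ {Q : AddSubgroup S | IsRightIdeal Q ∧ Q₀ ≤ Q ∧ g ∉ Q} (by
    intro c hc hchain Y hY
    have hdir : DirectedOn (· ≤ ·) c := hchain.directedOn
    refine ⟨sSup c, ⟨?_, (hc hY).2.1.trans (le_sSup hY), ?_⟩, fun z hz => le_sSup hz⟩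
    · intro q hq r
      rw [AddSubgroup.mem_sSup_of_directedOn ⟨Y, hY⟩ hdir] at hq ⊢
      obtain ⟨Z, hZ, hqZ⟩ := hq
      exact ⟨Z, hZ, (hc hZ).1 q hqZ r⟩
    · rw [AddSubgroup.mem_sSup_of_directedOn ⟨Y, hY⟩ hdir]
      rintro ⟨Z, hZ, hgZ⟩
      exact (hc hZ).2.2 hgZ) Q₀ ⟨hQ₀, le_rfl, fun ⟨a, ha⟩ => hg a ha⟩
  refine ⟨Q, ⟨⟨hQ.prop.1, ?_⟩, ?_⟩, hQ.prop.1, g, fun a => hle ⟨a, rfl⟩⟩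
  · intro h
    exact hQ.prop.2.2 (h ▸ AddSubgroup.mem_top g)
  · rintro Q' ⟨hQ', hne⟩ hQQ'
    refine hQ.le_of_ge ⟨hQ', hle.trans hQQ', fun hgQ' => hne (eq_top_iff.2 fun a _ => ?_)⟩ hQQ'
    have := Q'.add_mem (hQQ' (hle ⟨a, rfl⟩)) (hQ' g hgQ' a)
    rwa [sub_add_cancel] at this

end Modular

/-! ### Annihilators and quotients of R[x] -/

namespace RngPoly

variable {R : Type*} [NonUnitalRing R]

/-- The annihilator of a simple `R[x]`-module, with `R` nil, is generated by constants. -/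
theorem mul_coeff_mem (hR : IsNilRing R) {Q : AddSubgroup (RngPoly R)}
    (hmax : IsMaximalRightIdeal Q) (hmod : IsModularRightIdeal Q) {f : RngPoly R}
    (hf : ∀ w, w * f ∈ Q) (w : RngPoly R) (n : ℕ) : w * monomial 0 (coeff f n) ∈ Q := by
  -- Although x need not belong to R[x], (x q) a = q (x a) is in Q for every a, and modularity gives
  -- x q ∈ Q.
  have hshift : ∀ q ∈ Q, shift q ∈ Q := fun q hq =>
    mem_of_forall_mul_mem hmax hmod fun a => by
      rw [← shift_mul, ← mul_shift]
      exact hmax.prop.1 q hq _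
  let x : AddMonoid.End (RngPoly R ⧸ Q) := QuotientAddGroup.map Q Q shift hshift
  have hx : ∀ a : RngPoly R, x (a : RngPoly R ⧸ Q) = (shift a : RngPoly R) := fun a => rfl
  have hxpow : ∀ (i : ℕ) (a : RngPoly R),
      (x ^ i) (a : RngPoly R ⧸ Q) = ((shift ^ i) a : RngPoly R) := by
    intro i a
    induction i with
    | zero => rfl
    | succ i ih => rw [pow_succ', pow_succ', AddMonoid.End.mul_apply, ih, hx]; rfl
  let act : (RngPoly R ⧸ Q) →+ R →+ (RngPoly R ⧸ Q) :=
    QuotientAddGroup.lift Q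
      { toFun := fun a => ((QuotientAddGroup.mk' Q).comp (AddMonoidHom.mulLeft a)).comp (monomial 0)
        map_zero' := by ext; simp
        map_add' := fun a b => by ext; simp [add_mul] } (by
        intro q hq
        ext r
        exact (QuotientAddGroup.eq_zero_iff _).2 (hmax.prop.1 q hq _))
  have hact : ∀ (a : RngPoly R) (r : R),
      act (a : RngPoly R ⧸ Q) r = ((a * monomial 0 r : RngPoly R) : RngPoly R ⧸ Q) :=
    fun a r => rfl
  have hsum : ∀ (a g : RngPoly R) (d : ℕ) (c : ℕ → R),
      g = ∑ i ∈ Finset.range d, monomial i (c i) →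
      ((a * g : RngPoly R) : RngPoly R ⧸ Q) =
        ∑ i ∈ Finset.range d, (x ^ i) (act (a : RngPoly R ⧸ Q) (c i)) := by
    rintro a _ d c rfl
    rw [Finset.mul_sum, ← QuotientAddGroup.mk'_apply, map_sum]
    refine Finset.sum_congr rfl fun i _ => ?_
    rw [hact, hxpow, ← mul_monomial]
    rfl
  have : Nontrivial (RngPoly R ⧸ Q) :=
    QuotientAddGroup.nontrivial_iff.2 hmax.prop.2
  obtain ⟨D, hD, hT⟩ := LaurentModule.exists_of_simple hR act
    (by
      intro v r s
      obtain ⟨a, rfl⟩ := QuotientAddGroup.mk_surjective v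
      rw [hact, hact, hact, mul_assoc, monomial_mul_monomial]) x
    (by
      intro v r
      obtain ⟨a, rfl⟩ := QuotientAddGroup.mk_surjective v
      rw [hact, hx, hx, hact, shift_mul])
    (by
      intro v hv w
      obtain ⟨a, rfl⟩ := QuotientAddGroup.mk_surjective v
      obtain ⟨b, rfl⟩ := QuotientAddGroup.mk_surjective w
      have ha : a ∉ Q := fun h => hv ((QuotientAddGroup.eq_zero_iff a).2 h)
      obtain ⟨g, hg⟩ := exists_sub_mul_mem hmax hmod ha b
      obtain ⟨d, hd⟩ := eq_sum_monomial g
      refine ⟨d, coeff g, ?_⟩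
      rw [← hsum a g d _ hd, eq_comm, QuotientAddGroup.eq]
      rwa [neg_add_eq_sub])
  obtain ⟨d, hd⟩ := eq_sum_monomial f
  have key := LaurentModule.coeff_annihilates hR D (coeff f) d (by
    intro v
    obtain ⟨a, rfl⟩ := QuotientAddGroup.mk_surjective v
    simp only [hT, hD]
    rw [← hsum a f d _ hd]
    exact (QuotientAddGroup.eq_zero_iff _).2 (hf a))
  by_cases hn : n < d
  · have := key n hn w
    rw [hD, hact] at this
    exact (QuotientAddGroup.eq_zero_iff _).1 this
  · have : coeff f n = 0 := by
      rw [hd]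
      have : ∀ s : Finset ℕ, (∀ i ∈ s, i ≠ n) →
          coeff (∑ i ∈ s, monomial i (coeff f i)) n = 0 := by
        intro s hs
        induction s using Finset.induction_on with
        | empty => rfl
        | insert i s hi ih =>
          rw [Finset.sum_insert hi, coeff_add, coeff_monomial,
            if_neg (hs i (Finset.mem_insert_self _ _)),
            ih fun j hj => hs j (Finset.mem_insert_of_mem hj), add_zero]
      exact this _ fun i hi => by have := Finset.mem_range.1 hi; omega
    rw [this, map_zero, mul_zero]
    exact Q.zero_mem

/-- The map of polynomial rings induced by a ring homomorphism. -/
noncomputable def map {R' : Type*} [NonUnitalRing R'] (φ : R →ₙ+* R') : RngPoly R →ₙ+* RngPoly R' :=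
  { lift fun n => (monomial n).comp φ.toAddMonoidHom with
    map_mul' := fun f g => by
      change lift (fun n => (monomial n).comp φ.toAddMonoidHom) (f * g) =
        lift (fun n => (monomial n).comp φ.toAddMonoidHom) f *
          lift (fun n => (monomial n).comp φ.toAddMonoidHom) g
      induction f using induction_on with
      | zero => simp
      | add f f' hf hf' => simp only [add_mul, map_add, hf, hf']
      | mono i a =>
        induction g using induction_on with
        | zero => simp
        | add g g' hg hg' => simp only [mul_add, map_add, hg, hg']
        | mono j b => simp [monomial_mul_monomial, lift_monomial] }

theorem map_monomial {R' : Type*} [NonUnitalRing R'] (φ : R →ₙ+* R') (n : ℕ) (a : R) :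
    map φ (monomial n a) = monomial n (φ a) := lift_monomial _ _ _

theorem coeff_map {R' : Type*} [NonUnitalRing R'] (φ : R →ₙ+* R') (f : RngPoly R) (n : ℕ) :
    coeff (map φ f) n = φ (coeff f n) := by
  induction f using induction_on with
  | zero => simp [coeff_zero]
  | add f g hf hg => simp only [map_add, coeff_add, hf, hg]
  | mono i a =>
    rw [map_monomial, coeff_monomial, coeff_monomial]
    split_ifs <;> simp

theorem map_surjective {R' : Type*} [NonUnitalRing R'] (φ : R →ₙ+* R')
    (hφ : Function.Surjective φ) : Function.Surjective (map φ) := by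
  intro g
  induction g using induction_on with
  | zero => exact ⟨0, map_zero _⟩
  | add f g hf hg =>
    obtain ⟨a, rfl⟩ := hf
    obtain ⟨b, rfl⟩ := hg
    exact ⟨a + b, map_add _ _ _⟩
  | mono n a =>
    obtain ⟨b, rfl⟩ := hφ a
    exact ⟨monomial n b, map_monomial _ _ _⟩

end RngPoly

theorem map_rngPow {R R' : Type*} [NonUnitalRing R] [NonUnitalRing R'] (φ : R →ₙ+* R') (a : R)
    (n : ℕ) : φ (rngPow a n) = rngPow (φ a) n := by
  induction n with
  | zero => rfl
  | succ n ih => rw [rngPow, rngPow, map_mul, ih]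

/-- The projection onto the quotient by a two-sided ideal. -/
def TwoSidedIdeal.toQuotient {R : Type*} [NonUnitalRing R] (I : TwoSidedIdeal R) :
    R →ₙ+* I.ringCon.Quotient where
  toFun a := (a : I.ringCon.Quotient)
  map_mul' _ _ := rfl
  map_zero' := rfl
  map_add' _ _ := rfl

theorem TwoSidedIdeal.toQuotient_surjective {R : Type*} [NonUnitalRing R] (I : TwoSidedIdeal R) :
    Function.Surjective I.toQuotient := Quotient.mk''_surjective

theorem TwoSidedIdeal.toQuotient_eq_zero {R : Type*} [NonUnitalRing R] (I : TwoSidedIdeal R)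
    {a : R} : I.toQuotient a = 0 ↔ a ∈ I :=
  (RingCon.eq I.ringCon).trans (I.mem_iff a).symm

theorem IsNilRing.of_surjective {R R' : Type*} [NonUnitalRing R] [NonUnitalRing R']
    (hR : IsNilRing R) (φ : R →ₙ+* R') (hφ : Function.Surjective φ) : IsNilRing R' := fun b => by
  obtain ⟨a, rfl⟩ := hφ b
  obtain ⟨n, hn⟩ := hR a
  exact ⟨n, by rw [← map_rngPow, hn, map_zero]⟩

/-- If `R[x]` is not quasi-regular, with `R` nil, some homomorphic image of `R` has a right
primitive polynomial ring. -/
theorem quasiRegular_of_not_primitive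
    (H : ∀ (R : Type u) [NonUnitalRing R], IsNilRing R → ¬ IsRightPrimitiveRing (RngPoly R))
    (R : Type u) [NonUnitalRing R] (hR : IsNilRing R) (g : RngPoly R) : ∃ a, g = a - g * a := by
  by_contra! hg
  obtain ⟨Q, hmax, hmod⟩ := exists_maximal_modular g hg
  -- The coefficients that annihilate R[x]/Q.
  let I : TwoSidedIdeal R := TwoSidedIdeal.mk' {r | ∀ w, w * RngPoly.monomial 0 r ∈ Q}
    (fun w => by simp [Q.zero_mem])
    (fun {a b} ha hb w => by rw [map_add, mul_add]; exact Q.add_mem (ha w) (hb w))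
    (fun {a} ha w => by rw [map_neg, mul_neg]; exact Q.neg_mem (ha w))
    (fun {a b} hb w => by
      rw [← Nat.add_zero 0, ← RngPoly.monomial_mul_monomial, ← mul_assoc]; exact hb _)
    (fun {a b} ha w => by
      rw [← Nat.add_zero 0, ← RngPoly.monomial_mul_monomial, ← mul_assoc]
      exact hmax.prop.1 _ (ha _) _)
  have hI : ∀ r, r ∈ I ↔ ∀ w, w * RngPoly.monomial 0 r ∈ Q := fun r =>
    TwoSidedIdeal.mem_mk' _ _ _ _ _ _ _
  have hshift : ∀ (n : ℕ), ∀ q ∈ Q, (RngPoly.shift ^ n) q ∈ Q := fun n q hq =>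
    mem_of_forall_mul_mem hmax hmod fun a => by
      have : (RngPoly.shift ^ n) q * a = q * (RngPoly.shift ^ n) a := by
        induction n with
        | zero => rfl
        | succ n ih =>
          rw [pow_succ', AddMonoid.End.mul_apply, AddMonoid.End.mul_apply, RngPoly.mul_shift, ← ih,
            RngPoly.shift_mul]
      rw [this]
      exact hmax.prop.1 q hq _
  let π := RngPoly.map I.toQuotient
  have hπ : Function.Surjective π := RngPoly.map_surjective _ I.toQuotient_surjective
  obtain ⟨b, hb⟩ := hmod.2
  -- The kernel I[x] lies in Q, so Q descends to (R/I)[x].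
  have hker : ∀ f, π f = 0 → f ∈ Q := by
    intro f hf
    have hfI : ∀ n, RngPoly.coeff f n ∈ I := fun n => by
      rw [← I.toQuotient_eq_zero, ← RngPoly.coeff_map]
      exact congrArg (fun g => RngPoly.coeff g n) hf
    have hmul : b * f ∈ Q := by
      obtain ⟨d, hd⟩ := RngPoly.eq_sum_monomial f
      rw [hd, Finset.mul_sum]
      refine AddSubgroup.sum_mem _ fun i _ => ?_
      rw [RngPoly.mul_monomial]
      exact hshift i _ ((hI _).1 (hfI i) b)
    have := Q.add_mem (hb f) hmul
    rwa [sub_add_cancel] at this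
  let Q' : AddSubgroup (RngPoly I.ringCon.Quotient) := Q.map π.toAddMonoidHom
  have hQ' : ∀ f, π f ∈ Q' ↔ f ∈ Q := by
    intro f
    constructor
    · rintro ⟨q, hq, hqf⟩
      have : f - q ∈ Q := hker _ (by rw [map_sub]; exact sub_eq_zero.2 hqf.symm)
      have := Q.add_mem this hq
      rwa [sub_add_cancel] at this
    · exact fun hf => ⟨f, hf, rfl⟩
  have hright : IsRightIdeal Q' := by
    intro q hq r
    obtain ⟨f, rfl⟩ := hπ q
    obtain ⟨r, rfl⟩ := hπ r
    rw [← map_mul, hQ']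
    exact hmax.prop.1 _ ((hQ' f).1 hq) _
  refine H I.ringCon.Quotient (hR.of_surjective _ I.toQuotient_surjective)
    ⟨Q', ⟨⟨hright, ?_⟩, ?_⟩, ⟨hright, π b, ?_⟩, ?_, ?_⟩
  · intro htop
    refine hmax.prop.2 (eq_top_iff.2 fun f _ => ?_)
    rw [← hQ', htop]
    exact AddSubgroup.mem_top _
  · rintro Y ⟨hY, hYtop⟩ hle q hq
    obtain ⟨f, rfl⟩ := hπ q
    rw [hQ']
    have hmem : ∀ h, h ∈ Y.comap π.toAddMonoidHom ↔ π h ∈ Y := fun h => Iff.rfl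
    refine hmax.le_of_ge (y := Y.comap π.toAddMonoidHom) ⟨fun h hh r => ?_, fun htop => ?_⟩ ?_ hq
    · rw [hmem] at hh ⊢
      rw [map_mul]
      exact hY _ hh _
    · refine hYtop (eq_top_iff.2 fun h _ => ?_)
      obtain ⟨h, rfl⟩ := hπ h
      rw [← hmem, htop]
      exact AddSubgroup.mem_top _
    · exact fun h hh => hle ((hQ' h).2 hh)
  · intro a
    obtain ⟨a, rfl⟩ := hπ a
    rw [← map_mul, ← map_sub, hQ']
    exact hb a
  · intro a ha
    have : a = 0 := (TwoSidedIdeal.mem_bot _).1 ha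
    rw [this]
    exact Q'.zero_mem
  -- A lift of an element of J annihilates R[x]/Q, so its coefficients lie in I and vanish in R/I.
  · intro J hJ q hq
    obtain ⟨f, rfl⟩ := hπ q
    have hf : ∀ w, w * f ∈ Q := fun w => by
      rw [← hQ', map_mul]
      exact hJ _ (J.mul_mem_left _ _ hq)
    refine (TwoSidedIdeal.mem_bot _).2 (RngPoly.ext fun n => ?_)
    rw [RngPoly.coeff_map, RngPoly.coeff_zero, I.toQuotient_eq_zero, hI]
    exact fun w => RngPoly.mul_coeff_mem hR hmax hmod hf w n

open Polynomial in
/-- The map from `R[x]` to polynomials over a ring with identity. -/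
noncomputable def RngPoly.toPolynomial {R U : Type*} [NonUnitalRing R] [Ring U] (φ : R →ₙ+* U) :
    RngPoly R →ₙ+* U[X] :=
  { RngPoly.lift fun n => (Polynomial.monomial n).toAddMonoidHom.comp φ.toAddMonoidHom with
    map_mul' := fun f g => by
      change RngPoly.lift (fun n => (Polynomial.monomial n).toAddMonoidHom.comp φ.toAddMonoidHom)
        (f * g) =
        RngPoly.lift (fun n => (Polynomial.monomial n).toAddMonoidHom.comp φ.toAddMonoidHom) f *
        RngPoly.lift (fun n => (Polynomial.monomial n).toAddMonoidHom.comp φ.toAddMonoidHom) g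
      induction f using RngPoly.induction_on with
      | zero => simp
      | add f f' hf hf' => simp only [add_mul, map_add, hf, hf']
      | mono i a =>
        induction g using RngPoly.induction_on with
        | zero => simp
        | add g g' hg hg' => simp only [mul_add, map_add, hg, hg']
        | mono j b =>
          simp [RngPoly.monomial_mul_monomial, RngPoly.lift_monomial,
            Polynomial.monomial_mul_monomial] }

theorem RngPoly.toPolynomial_monomial {R U : Type*} [NonUnitalRing R] [Ring U] (φ : R →ₙ+* U)
    (n : ℕ) (a : R) :
    RngPoly.toPolynomial φ (RngPoly.monomial n a) = Polynomial.monomial n (φ a) :=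
  RngPoly.lift_monomial _ _ _

theorem rngPow_eq_pow {U : Type*} [Ring U] (a : U) (n : ℕ) : rngPow a n = a ^ (n + 1) := by
  induction n with
  | zero => simp [rngPow]
  | succ n ih => rw [rngPow, ih, ← pow_succ]

/-! ### From quasi-regularity to the Köthe conjecture -/

section Unitization

variable {S : Type*} [NonUnitalRing S]

/-- The ring with identity `ℤ ⊕ S`. -/
def RngUnitization (S : Type*) [NonUnitalRing S] : Type _ := Unitization ℤ S

instance : Ring (RngUnitization S) := inferInstanceAs (Ring (Unitization ℤ S))

/-- The inclusion of a ring in its unitization. -/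
def inrRingHom (S : Type*) [NonUnitalRing S] : S →ₙ+* RngUnitization S where
  toFun := fun a => (Unitization.inr a : Unitization ℤ S)
  map_mul' := fun a b => Unitization.inr_mul ℤ a b
  map_zero' := Unitization.inr_zero ℤ
  map_add' := fun a b => Unitization.inr_add ℤ a b

/-- The augmentation of the unitization. -/
def augmentation (S : Type*) [NonUnitalRing S] : RngUnitization S →+* ℤ where
  toFun := fun a => (show Unitization ℤ S from a).fst
  map_one' := rfl
  map_mul' := fun _ _ => rfl
  map_zero' := rfl
  map_add' := fun _ _ => rfl

theorem augmentation_eq_zero_iff {y : RngUnitization S} :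
    augmentation S y = 0 ↔ ∃ s, inrRingHom S s = y := by
  constructor
  · intro h
    exact ⟨(show Unitization ℤ S from y).snd, Unitization.ext h.symm rfl⟩
  · rintro ⟨s, rfl⟩
    rfl

theorem inrRingHom_injective : Function.Injective (inrRingHom S) :=
  Unitization.inr_injective (R := ℤ)

theorem inrRingHom_pow (a : S) (n : ℕ) : inrRingHom S a ^ (n + 1) = inrRingHom S (rngPow a n) := by
  rw [map_rngPow (inrRingHom S), rngPow_eq_pow]

theorem rngNilpotent_iff_inr (a : S) : RngNilpotent a ↔ IsNilpotent (inrRingHom S a) := by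
  constructor
  · rintro ⟨n, hn⟩
    exact ⟨n + 1, by rw [inrRingHom_pow, hn, map_zero]⟩
  · rintro ⟨n, hn⟩
    refine ⟨n, inrRingHom_injective ?_⟩
    rw [← inrRingHom_pow, pow_succ, hn, zero_mul, map_zero]

theorem exists_mul_inr (y : RngUnitization S) :
    ∃ (n : ℤ) (s : S), ∀ q, y * inrRingHom S q = inrRingHom S (n • q + s * q) ∧
      inrRingHom S q * y = inrRingHom S (n • q + q * s) := by
  refine ⟨(show Unitization ℤ S from y).fst, (show Unitization ℤ S from y).snd,
    fun q => ⟨?_, ?_⟩⟩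
  · refine Unitization.ext (mul_zero _) ?_
    refine (Unitization.snd_mul (R := ℤ) (A := S) y (Unitization.inr q)).trans ?_
    simp only [Unitization.fst_inr, Unitization.snd_inr, zero_smul, add_zero]
    rfl
  · refine Unitization.ext (zero_mul _) ?_
    refine (Unitization.snd_mul (R := ℤ) (A := S) (Unitization.inr q) y).trans ?_
    simp only [Unitization.fst_inr, Unitization.snd_inr, zero_smul, zero_add]
    rfl

theorem isNilpotent_mul_swap {U : Type*} [Ring U] {a b : U} (h : IsNilpotent (a * b)) :
    IsNilpotent (b * a) := by
  obtain ⟨n, hn⟩ := h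
  have key : ∀ n : ℕ, (b * a) ^ (n + 1) = b * (a * b) ^ n * a := by
    intro n
    induction n with
    | zero => simp
    | succ n ih => rw [pow_succ, ih, pow_succ]; simp only [mul_assoc]
  exact ⟨n + 1, by rw [key, hn, mul_zero, zero_mul]⟩

open Polynomial in
/-- If `s` is in the Jacobson radical of the polynomial ring, it is nilpotent. -/
theorem isNilpotent_of_C_mem_jacobson {U : Type*} [Ring U] {s : U}
    (hs : C s ∈ (⊥ : Ideal U[X]).jacobson) : IsNilpotent s := by
  obtain ⟨z, hz⟩ := Ideal.mem_jacobson_iff.1 hs (-X)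
  rw [Ideal.mem_bot, sub_eq_zero] at hz
  -- A left inverse of 1 - sX is the geometric series; being a polynomial, it terminates.
  have hcoeff : ∀ n, z.coeff n = s ^ n := by
    intro n
    induction n with
    | zero =>
      have := congrArg (fun p => p.coeff 0) hz
      simpa [mul_assoc] using this
    | succ n ih =>
      have := congrArg (fun p => p.coeff (n + 1)) hz
      simp only [mul_neg, neg_mul, coeff_add, coeff_neg, coeff_mul_C, coeff_mul_X, ih,
        coeff_one] at this
      rw [if_neg (Nat.succ_ne_zero n), neg_add_eq_zero] at this
      rw [← this, pow_succ]
  exact ⟨z.natDegree + 1, by rw [← hcoeff]; exact coeff_eq_zero_of_natDegree_lt (Nat.lt_succ_self _)⟩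

/-- The left ideal `S q + ℤ q`. -/
def leftPrincipal (q : S) : NonUnitalSubring S where
  carrier := {a | ∃ y, inrRingHom S a = y * inrRingHom S q}
  zero_mem' := ⟨0, by simp⟩
  add_mem' := by
    rintro a b ⟨y, hy⟩ ⟨z, hz⟩
    exact ⟨y + z, by rw [map_add, hy, hz, add_mul]⟩
  neg_mem' := by
    rintro a ⟨y, hy⟩
    exact ⟨-y, by rw [map_neg, hy, neg_mul]⟩
  mul_mem' := by
    rintro a b _ ⟨z, hz⟩
    exact ⟨inrRingHom S a * z, by rw [map_mul, hz]; exact (mul_assoc _ _ _).symm⟩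

theorem isNilRing_leftPrincipal {q : S} (h : ∀ y, IsNilpotent (y * inrRingHom S q)) :
    IsNilRing (leftPrincipal q) := by
  rintro ⟨a, y, hy⟩
  obtain ⟨n, hn⟩ := (rngNilpotent_iff_inr a).2 (hy ▸ h y)
  refine ⟨n, Subtype.ext ?_⟩
  have := map_rngPow (NonUnitalSubringClass.subtype (leftPrincipal q)) ⟨a, y, hy⟩ n
  exact this.trans hn

open Polynomial in
/-- If all polynomials over nil rings are quasi-regular, then `q` is in the Jacobson radical of the
polynomial ring when its left multiples are nilpotent. -/
theorem C_mem_jacobson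
    (H : ∀ (R : Type u) [NonUnitalRing R], IsNilRing R → ∀ g : RngPoly R, ∃ a, g = a - g * a)
    {S : Type u} [NonUnitalRing S] {q : S} (h : ∀ y, IsNilpotent (y * inrRingHom S q)) :
    C (inrRingHom S q) ∈ (⊥ : Ideal (RngUnitization S)[X]).jacobson := by
  let L := leftPrincipal q
  let ι : L →ₙ+* RngUnitization S := (inrRingHom S).comp (NonUnitalSubringClass.subtype L)
  let θ := RngPoly.toPolynomial ι
  rw [Ideal.mem_jacobson_iff]
  intro y
  -- The coefficients of y q lie in the left ideal generated by q, which is itself a nil ring.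
  obtain ⟨g, hg⟩ : ∃ g : RngPoly L, θ g = -(y * C (inrRingHom S q)) := by
    induction y using Polynomial.induction_on' with
    | add y z hy hz =>
      obtain ⟨f, hf⟩ := hy
      obtain ⟨g, hg⟩ := hz
      exact ⟨f + g, by rw [map_add, hf, hg, add_mul, neg_add]⟩
    | monomial n y =>
      obtain ⟨k, s, hks⟩ := exists_mul_inr y
      have hmem : -(k • q + s * q) ∈ L := L.neg_mem ⟨y, (hks q).1.symm⟩
      refine ⟨RngPoly.monomial n ⟨_, hmem⟩, ?_⟩
      rw [RngPoly.toPolynomial_monomial, monomial_mul_C, (hks q).1, ← map_neg, ← map_neg]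
      rfl
  obtain ⟨a, ha⟩ := H L (isNilRing_leftPrincipal h) g
  -- The first application gives a right inverse 1 + a of 1 - g; making 1 + a right invertible too
  -- shows that the inverse is two-sided.
  obtain ⟨b, hb⟩ := H L (isNilRing_leftPrincipal h) (-a)
  have h1 : (1 - θ g) * (1 + θ a) = 1 := by
    have := congrArg θ ha
    rw [map_sub, map_mul] at this
    calc (1 - θ g) * (1 + θ a) = 1 + (θ a - θ g * θ a - θ g) := by noncomm_ring
      _ = 1 := by rw [← this, sub_self, add_zero]
  have h2 : (1 + θ a) * (1 + θ b) = 1 := by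
    have := congrArg θ hb
    rw [map_sub, map_mul, map_neg, neg_mul, sub_neg_eq_add] at this
    calc (1 + θ a) * (1 + θ b) = 1 + (θ b + θ a * θ b + θ a) := by noncomm_ring
      _ = 1 := by rw [← this, neg_add_cancel, add_zero]
  have h3 : (1 + θ a) * (1 - θ g) = 1 := by
    rwa [← left_inv_eq_right_inv h1 h2] at h2
  refine ⟨1 + θ a, ?_⟩
  rw [hg, sub_neg_eq_add, mul_add, mul_one] at h3
  rw [Ideal.mem_bot, sub_eq_zero, mul_assoc, add_comm, h3]

/-- If all polynomials over nil rings are quasi-regular, the Köthe conjecture holds. -/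
theorem koethe_of_quasiRegular
    (H : ∀ (R : Type u) [NonUnitalRing R], IsNilRing R → ∀ g : RngPoly R, ∃ a, g = a - g * a) :
    KoetheConjecture.{u} := by
  intro S _ hS Q hQ hnil
  let J : Ideal (Polynomial (RngUnitization S)) := (⊥ : Ideal _).jacobson
  let K : TwoSidedIdeal S := TwoSidedIdeal.mk' {s | Polynomial.C (inrRingHom S s) ∈ J}
    (by simp)
    (fun {a b} ha hb => by
      simp only [Set.mem_ofPred_eq, map_add] at *
      exact J.add_mem ha hb)
    (fun {a} ha => by
      simp only [Set.mem_ofPred_eq, map_neg] at *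
      exact J.neg_mem ha)
    (fun {a b} hb => by
      simp only [Set.mem_ofPred_eq, map_mul] at *
      exact J.mul_mem_left _ hb)
    (fun {a b} ha => by
      simp only [Set.mem_ofPred_eq, map_mul] at *
      exact J.mul_mem_right _ ha)
  have hK : ∀ s, s ∈ K ↔ Polynomial.C (inrRingHom S s) ∈ J := fun s =>
    TwoSidedIdeal.mem_mk' _ _ _ _ _ _ _
  have hbot : K = ⊥ := hS K fun a ha =>
    (rngNilpotent_iff_inr a).2 (isNilpotent_of_C_mem_jacobson ((hK a).1 ha))
  refine eq_bot_iff.2 fun q hq => ?_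
  have hq' : ∀ y, IsNilpotent (y * inrRingHom S q) := by
    intro y
    obtain ⟨k, s, hks⟩ := exists_mul_inr y
    rcases hQ with hQ | hQ
    · apply isNilpotent_mul_swap
      rw [(hks q).2, ← rngNilpotent_iff_inr]
      exact hnil _ (Q.add_mem (Q.zsmul_mem hq _) (hQ q hq _))
    · rw [(hks q).1, ← rngNilpotent_iff_inr]
      exact hnil _ (Q.add_mem (Q.zsmul_mem hq _) (hQ q hq _))
  have : q ∈ K := (hK q).2 (C_mem_jacobson H hq')
  rw [hbot] at this
  exact (TwoSidedIdeal.mem_bot _).1 this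

end Unitization

/-! ### Nil ideals under the Köthe conjecture -/

/-- A two-sided ideal whose elements are nilpotent. -/
def IsNilIdeal {T : Type*} [NonUnitalRing T] (I : TwoSidedIdeal T) : Prop :=
  ∀ a ∈ I, RngNilpotent a

theorem RngNilpotent.of_rngPow {T : Type*} [NonUnitalRing T] {a : T} {n : ℕ}
    (h : RngNilpotent (rngPow a n)) : RngNilpotent a := by
  rw [rngNilpotent_iff_inr, ← inrRingHom_pow] at h
  obtain ⟨m, hm⟩ := h
  exact (rngNilpotent_iff_inr a).2 ⟨(n + 1) * m, by rw [pow_mul, hm]⟩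

theorem exists_maximal_nilIdeal (T : Type*) [NonUnitalRing T] :
    ∃ I : TwoSidedIdeal T, Maximal IsNilIdeal I := by
  obtain ⟨I, _, hI⟩ := zorn_le_nonempty₀ {I : TwoSidedIdeal T | IsNilIdeal I} (by
    intro c hc hchain Y hY
    have hdir : ∀ {I J}, I ∈ c → J ∈ c → ∃ K ∈ c, I ≤ K ∧ J ≤ K := fun {I J} hI hJ => by
      rcases hchain.total hI hJ with h | h
      · exact ⟨J, hJ, h, le_rfl⟩
      · exact ⟨I, hI, le_rfl, h⟩
    let U : TwoSidedIdeal T := TwoSidedIdeal.mk' {a | ∃ I ∈ c, a ∈ I}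
      ⟨Y, hY, Y.zero_mem⟩
      (by
        rintro a b ⟨I, hI, ha⟩ ⟨J, hJ, hb⟩
        obtain ⟨K, hK, h1, h2⟩ := hdir hI hJ
        exact ⟨K, hK, K.add_mem (h1 ha) (h2 hb)⟩)
      (by rintro a ⟨I, hI, ha⟩; exact ⟨I, hI, I.neg_mem ha⟩)
      (by rintro a b ⟨I, hI, hb⟩; exact ⟨I, hI, I.mul_mem_left _ _ hb⟩)
      (by rintro a b ⟨I, hI, ha⟩; exact ⟨I, hI, I.mul_mem_right _ _ ha⟩)
    have hU : ∀ a, a ∈ U ↔ ∃ I ∈ c, a ∈ I := fun a => TwoSidedIdeal.mem_mk' _ _ _ _ _ _ _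
    refine ⟨U, fun a ha => ?_, fun I hI a ha => (hU a).2 ⟨I, hI, ha⟩⟩
    obtain ⟨I, hI, ha⟩ := (hU a).1 ha
    exact hc hI a ha) ⊥ (fun a ha => ⟨0, (TwoSidedIdeal.mem_bot _).1 ha⟩)
  exact ⟨I, hI⟩

/-- Under the Köthe conjecture some nil ideal contains all nil one-sided ideals. -/
theorem KoetheConjecture.exists_nilIdeal (H : KoetheConjecture.{u}) (T : Type u)
    [NonUnitalRing T] : ∃ I : TwoSidedIdeal T, IsNilIdeal I ∧
      ∀ Q : AddSubgroup T, IsRightIdeal Q ∨ IsLeftIdeal Q → (∀ a ∈ Q, RngNilpotent a) →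
        ∀ a ∈ Q, a ∈ I := by
  obtain ⟨I, hI⟩ := exists_maximal_nilIdeal T
  refine ⟨I, hI.prop, fun Q hQ hnil a ha => ?_⟩
  let π := I.toQuotient
  have hπ : Function.Surjective π := I.toQuotient_surjective
  -- The preimage of a nil ideal of T/I is nil, since a power of each element lands in the nil ideal
  -- I; maximality then makes it I.
  have hred : ∀ J : TwoSidedIdeal I.ringCon.Quotient, (∀ a ∈ J, RngNilpotent a) → J = ⊥ := by
    intro J hJ
    let J' : TwoSidedIdeal T := TwoSidedIdeal.mk' {a | π a ∈ J}
      (by simp only [Set.mem_ofPred_eq, map_zero]; exact J.zero_mem)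
      (fun {a b} ha hb => by
        simp only [Set.mem_ofPred_eq, map_add] at *; exact J.add_mem ha hb)
      (fun {a} ha => by simp only [Set.mem_ofPred_eq, map_neg] at *; exact J.neg_mem ha)
      (fun {a b} hb => by
        simp only [Set.mem_ofPred_eq, map_mul] at *; exact J.mul_mem_left _ _ hb)
      (fun {a b} ha => by
        simp only [Set.mem_ofPred_eq, map_mul] at *; exact J.mul_mem_right _ _ ha)
    have hJ' : ∀ a, a ∈ J' ↔ π a ∈ J := fun a => TwoSidedIdeal.mem_mk' _ _ _ _ _ _ _
    have hnilJ' : IsNilIdeal J' := by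
      intro a ha
      obtain ⟨n, hn⟩ := hJ _ ((hJ' a).1 ha)
      rw [← map_rngPow, I.toQuotient_eq_zero] at hn
      exact (hI.prop _ hn).of_rngPow
    have hle : I ≤ J' := fun a ha => (hJ' a).2 (by
      rw [I.toQuotient_eq_zero.2 ha]
      exact J.zero_mem)
    have hge : J' ≤ I := hI.le_of_ge hnilJ' hle
    refine TwoSidedIdeal.ext fun b => ?_
    rw [TwoSidedIdeal.mem_bot]
    constructor
    · intro hb
      obtain ⟨a, rfl⟩ := hπ b
      exact I.toQuotient_eq_zero.2 (hge ((hJ' a).2 hb))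
    · rintro rfl
      exact J.zero_mem
  have himage : Q.map π.toAddMonoidHom = ⊥ := by
    refine H _ hred _ ?_ ?_
    · refine hQ.imp (fun hQ => ?_) (fun hQ => ?_)
      · rintro _ ⟨q, hq, rfl⟩ r
        obtain ⟨r, rfl⟩ := hπ r
        exact ⟨q * r, hQ q hq r, map_mul π q r⟩
      · rintro _ ⟨q, hq, rfl⟩ r
        obtain ⟨r, rfl⟩ := hπ r
        exact ⟨r * q, hQ q hq r, map_mul π r q⟩
    · rintro _ ⟨q, hq, rfl⟩
      obtain ⟨n, hn⟩ := hnil q hq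
      exact ⟨n, (map_rngPow π q n).symm.trans (by rw [hn, map_zero])⟩
  have : π a ∈ Q.map π.toAddMonoidHom := ⟨a, ha, rfl⟩
  rw [himage] at this
  exact I.toQuotient_eq_zero.1 this

/-! ### Nilpotent matrices and inversion of 1 - f -/

section Matrices

variable {R : Type u} [NonUnitalRing R]

theorem isNilpotent_of_augmentation_eq_zero (hR : IsNilRing R) {y : RngUnitization R}
    (hy : augmentation R y = 0) : IsNilpotent y := by
  obtain ⟨s, rfl⟩ := augmentation_eq_zero_iff.1 hy
  exact (rngNilpotent_iff_inr s).1 (hR s)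

theorem pow_succ_apply_of_column {U : Type*} [Ring U] {n : ℕ} {M : Matrix (Fin n) (Fin n) U}
    {j : Fin n} (hM : ∀ i l, l ≠ j → M i l = 0) (k : ℕ) (i l : Fin n) :
    (M ^ (k + 1)) i l = if l = j then M i j * M j j ^ k else 0 := by
  induction k generalizing l with
  | zero =>
    split_ifs with h
    · simp [h]
    · simpa using hM i l h
  | succ k ih =>
    rw [pow_succ, Matrix.mul_apply, Finset.sum_eq_single j]
    · rw [ih, if_pos rfl]
      split_ifs with h
      · rw [h, mul_assoc, ← pow_succ]
      · rw [hM j l h, mul_zero]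
    · intro p _ hp
      rw [ih, if_neg hp, zero_mul]
    · simp

/-- Under the Köthe conjecture, matrices over a nil ring are nilpotent. -/
theorem KoetheConjecture.isNilpotent_matrix (H : KoetheConjecture.{u}) (hR : IsNilRing R) {n : ℕ}
    {M : Matrix (Fin n) (Fin n) (RngUnitization R)} (hM : ∀ i l, augmentation R (M i l) = 0) :
    IsNilpotent M := by
  classical
  obtain ⟨I, hI, hIQ⟩ := H.exists_nilIdeal (Matrix (Fin n) (Fin n) (RngUnitization R))
  -- The matrices over R supported in column j form a left ideal. It is nil because every entry of
  -- A^(k+1) has the right factor A_jj^k or is zero.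
  let L : Fin n → AddSubgroup (Matrix (Fin n) (Fin n) (RngUnitization R)) := fun j =>
    { carrier := {A | (∀ i l, augmentation R (A i l) = 0) ∧ ∀ i l, l ≠ j → A i l = 0}
      zero_mem' := ⟨fun i l => by simp, fun i l _ => rfl⟩
      add_mem' := fun {A B} hA hB => ⟨fun i l => by simp [hA.1 i l, hB.1 i l],
        fun i l h => by simp [hA.2 i l h, hB.2 i l h]⟩
      neg_mem' := fun {A} hA => ⟨fun i l => by simp [hA.1 i l], fun i l h => by simp [hA.2 i l h]⟩ }
  have hLleft : ∀ j, IsLeftIdeal (L j) := by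
    rintro j A ⟨hA, hA'⟩ B
    refine ⟨fun i l => ?_, fun i l h => ?_⟩
    · simp [Matrix.mul_apply, hA]
    · simp [Matrix.mul_apply, hA' _ l h]
  have hLnil : ∀ j, ∀ A ∈ L j, RngNilpotent A := by
    rintro j A ⟨hA, hA'⟩
    obtain ⟨k, hk⟩ := isNilpotent_of_augmentation_eq_zero hR (hA j j)
    refine ⟨k, ?_⟩
    rw [rngPow_eq_pow]
    ext i l
    rw [pow_succ_apply_of_column hA', hk]
    simp
  have hsum : M = ∑ j, Matrix.of fun i l => if l = j then M i l else 0 := by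
    ext i l
    simp [Matrix.sum_apply]
  have hmem : M ∈ I := by
    rw [hsum]
    refine sum_mem fun j _ => hIQ (L j) (Or.inr (hLleft j)) (hLnil j) _ ⟨fun i l => ?_, fun i l h => ?_⟩
    · rw [Matrix.of_apply]
      split_ifs
      · exact hM i l
      · exact map_zero _
    · rw [Matrix.of_apply, if_neg h]
  obtain ⟨k, hk⟩ := hI M hmem
  exact ⟨k + 1, by rwa [rngPow_eq_pow] at hk⟩

open Polynomial

/-- The companion matrix of `1 - f`, acting on row vectors. -/
noncomputable def companion {U : Type*} [Ring U] (f : U[X]) (n : ℕ) :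
    Matrix (Fin (n + 1)) (Fin (n + 1)) U :=
  Matrix.of fun i l => (if l = 0 then f.coeff (i + 1) else 0) + if (l : ℕ) = i + 1 then 1 else 0

/-- Each factor advances the index by exactly one, so the n-th power of an n × n matrix of this kind
is zero. -/
theorem shift_pow_apply_eq_zero {n : ℕ} {N : Matrix (Fin n) (Fin n) ℤ}
    (hN : ∀ i l : Fin n, (l : ℕ) ≠ i + 1 → N i l = 0) (k : ℕ) (i l : Fin n) (h : (l : ℕ) < i + k) :
    (N ^ k) i l = 0 := by
  induction k generalizing i with
  | zero =>
    rw [pow_zero, Matrix.one_apply_ne]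
    rintro rfl
    omega
  | succ k ih =>
    rw [pow_succ', Matrix.mul_apply]
    refine Finset.sum_eq_zero fun p _ => ?_
    by_cases hp : (p : ℕ) = i + 1
    · rw [ih p (by omega), mul_zero]
    · rw [hN i p hp, zero_mul]

theorem KoetheConjecture.isNilpotent_companion (H : KoetheConjecture.{u}) (hR : IsNilRing R)
    {f : (RngUnitization R)[X]} (hf : ∀ i, augmentation R (f.coeff i) = 0) (n : ℕ) :
    IsNilpotent (companion f n) := by
  -- Modulo R only the ones on the superdiagonal remain, so the (n+1)-st power has entries in R.
  have hN : ((companion f n).map (augmentation R)) ^ (n + 1) = 0 := by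
    ext i l
    refine shift_pow_apply_eq_zero (fun i l h => ?_) _ _ _ (by omega)
    simp only [companion, Matrix.map_apply, Matrix.of_apply, if_neg h, add_zero]
    split_ifs
    · exact hf _
    · exact map_zero _
  have hpow : IsNilpotent (companion f n ^ (n + 1)) := by
    refine H.isNilpotent_matrix hR fun i l => ?_
    have := congrFun (congrFun ((Matrix.map_pow _ (augmentation R) _).trans hN) i) l
    exact this
  obtain ⟨m, hm⟩ := hpow
  exact ⟨(n + 1) * m, by rw [pow_mul, hm]⟩

/-- If the companion matrix is nilpotent, `1 - f` is right invertible. -/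
theorem exists_mul_eq_one_of_companion {U : Type*} [Ring U] {f : U[X]} (hf0 : f.coeff 0 = 0)
    (hA : IsNilpotent (companion f f.natDegree)) : ∃ z, (1 - f) * z = 1 := by
  set n := f.natDegree with hn
  let D : Matrix (Fin (n + 1)) (Fin (n + 1)) U[X] := Matrix.scalar _ X
  let A : Matrix (Fin (n + 1)) (Fin (n + 1)) U[X] := (companion f n).map C
  have hAnil : IsNilpotent A := by
    obtain ⟨k, hk⟩ := hA
    refine ⟨k, ?_⟩
    have := Matrix.map_pow (companion f n) C k
    rw [hk] at this
    rw [← this]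
    ext
    simp
  have hcomm : Commute A D := by
    refine (Matrix.scalar_commute X (fun r => (commute_X r)) A).symm
  have hY : IsNilpotent (A * D) := hcomm.isNilpotent_mul_right hAnil
  obtain ⟨B, hB⟩ := hY.isUnit_one_sub.exists_right_inv
  have hYapply : ∀ i l, (A * D) i l = C (companion f n i l) * X := by
    intro i l
    simp [A, D]
  -- The row (1, X, ..., X^n) times A X is (f, X, ..., X^n): column 0 assembles f because f has no
  -- constant term, and the others shift.
  let ξ : Fin (n + 1) → U[X] := fun i => X ^ (i : ℕ)
  have hξ : Matrix.vecMul ξ (1 - A * D) = Pi.single 0 (1 - f) := by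
    rw [Matrix.vecMul_sub, Matrix.vecMul_one]
    ext1 l
    rw [Pi.sub_apply]
    have hsum : Matrix.vecMul ξ (A * D) l = ∑ i : Fin (n + 1), X ^ (i : ℕ) *
        (C (companion f n i l) * X) := by
      simp only [Matrix.vecMul, dotProduct, hYapply, ξ]
    rw [hsum]
    refine Fin.cases ?_ (fun k => ?_) l
    · rw [Pi.single_eq_same]
      have : ∑ i : Fin (n + 1), X ^ (i : ℕ) * (C (companion f n i 0) * X) = f := by
        conv_rhs => rw [f.as_sum_range' (n + 2) (by omega), Finset.sum_range_succ', hf0]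
        rw [Finset.sum_range]
        simp only [monomial_zero_right, add_zero]
        refine Finset.sum_congr rfl fun i _ => ?_
        rw [← mul_assoc, X_pow_mul, mul_assoc, ← pow_succ, ← C_mul_X_pow_eq_monomial]
        simp [companion]
      rw [this]
      simp [ξ]
    · rw [Pi.single_eq_of_ne (Fin.succ_ne_zero k), sub_eq_zero,
        Finset.sum_eq_single (Fin.castSucc k)]
      · simp [companion, ξ, pow_succ]
      · intro i _ hi
        have h1 : (k.succ : ℕ) ≠ i + 1 := by
          intro h
          apply hi
          ext
          simp at h ⊢
          omega
        simp only [companion, Matrix.of_apply, if_neg h1, if_neg (Fin.succ_ne_zero k), add_zero,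
          C_0, zero_mul, mul_zero]
      · simp
  have key : ξ = Matrix.vecMul (Pi.single 0 (1 - f)) B := by
    rw [← hξ, Matrix.vecMul_vecMul, hB, Matrix.vecMul_one]
  refine ⟨B 0 0, ?_⟩
  have := congrFun key 0
  rw [Matrix.single_vecMul] at this
  simpa [ξ] using this.symm

theorem RngPoly.coeff_toPolynomial {U : Type*} [Ring U] (φ : R →ₙ+* U) (g : RngPoly R) (n : ℕ) :
    (RngPoly.toPolynomial φ g).coeff n = φ (RngPoly.coeff g n) := by
  induction g using RngPoly.induction_on with
  | zero => simp [RngPoly.coeff_zero]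
  | add f g hf hg => rw [map_add, Polynomial.coeff_add, hf, hg, RngPoly.coeff_add, map_add]
  | mono i a =>
    rw [RngPoly.toPolynomial_monomial, Polynomial.coeff_monomial, RngPoly.coeff_monomial]
    split_ifs
    · rfl
    · exact (map_zero φ).symm

theorem RngPoly.exists_toPolynomial_eq {p : (RngUnitization R)[X]}
    (hp : ∀ i, augmentation R (p.coeff i) = 0) :
    ∃ g, RngPoly.toPolynomial (inrRingHom R) g = p := by
  choose s hs using fun i => augmentation_eq_zero_iff.1 (hp i)
  refine ⟨∑ i ∈ Finset.range (p.natDegree + 1), RngPoly.monomial i (s i), ?_⟩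
  rw [map_sum]
  conv_rhs => rw [p.as_sum_range]
  simp only [RngPoly.toPolynomial_monomial, hs]

/-- Under the Köthe conjecture, polynomials over nil rings are quasi-regular. -/
theorem KoetheConjecture.quasiRegular (H : KoetheConjecture.{u}) (hR : IsNilRing R)
    (g : RngPoly R) : ∃ a, g = a - g * a := by
  let θ := RngPoly.toPolynomial (inrRingHom R)
  have haug : ∀ (h : RngPoly R) i, augmentation R ((θ h).coeff i) = 0 := fun h i =>
    augmentation_eq_zero_iff.2 ⟨_, (RngPoly.coeff_toPolynomial _ _ _).symm⟩
  set f := θ g with hf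
  have hconst : IsNilpotent (f.coeff 0) := isNilpotent_of_augmentation_eq_zero hR (haug g 0)
  obtain ⟨v, hv⟩ := hconst.isUnit_one_sub.exists_right_inv
  -- Dividing 1 - f by its invertible constant term reduces to the case of zero constant term.
  let f' := C v * (f - C (f.coeff 0))
  have hf'0 : f'.coeff 0 = 0 := by simp [f']
  have hf' : ∀ i, augmentation R (f'.coeff i) = 0 := by
    intro i
    rcases i with _ | i
    · rw [hf'0, map_zero]
    · simp only [f', coeff_C_mul, coeff_sub, coeff_C_succ, sub_zero, map_mul]
      rw [haug g, mul_zero]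
  have hfac : 1 - f = C (1 - f.coeff 0) * (1 - f') := by
    rw [mul_sub, ← mul_assoc, ← C_mul, hv, C_1, one_mul, mul_one, C_sub, C_1]
    abel
  obtain ⟨z', hz'⟩ := exists_mul_eq_one_of_companion hf'0
    (H.isNilpotent_companion hR hf' _)
  have hz : (1 - f) * (z' * C v) = 1 := by
    rw [hfac, mul_assoc, ← mul_assoc _ z', hz', one_mul, ← C_mul, hv, C_1]
  have hmapf : f.map (augmentation R) = 0 := by
    ext i
    rw [coeff_map, haug g, Polynomial.coeff_zero]
  -- The inverse is 1 modulo R, so subtracting 1 gives a polynomial over R.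
  have hmapz : (z' * C v).map (augmentation R) = 1 := by
    have := congrArg (Polynomial.map (augmentation R)) hz
    rwa [Polynomial.map_mul, Polynomial.map_sub, hmapf, Polynomial.map_one, sub_zero,
      one_mul] at this
  obtain ⟨a, ha⟩ := RngPoly.exists_toPolynomial_eq (p := z' * C v - 1) (fun i => by
    rw [← coeff_map, Polynomial.map_sub, hmapz, Polynomial.map_one, sub_self,
      Polynomial.coeff_zero])
  refine ⟨a, RngPoly.ext fun i => inrRingHom_injective ?_⟩
  rw [← RngPoly.coeff_toPolynomial, ← RngPoly.coeff_toPolynomial, map_sub, map_mul]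
  congr 1
  change f = RngPoly.toPolynomial (inrRingHom R) a - f * RngPoly.toPolynomial (inrRingHom R) a
  rw [ha]
  calc f = f + ((1 - f) * (z' * C v) - 1) := by rw [hz, sub_self, add_zero]
    _ = z' * C v - 1 - f * (z' * C v - 1) := by noncomm_ring

end Matrices

theorem corollary2 :
    KoetheConjecture.{u} ↔
      ∀ (R : Type u) [NonUnitalRing R], IsNilRing R → ¬ IsRightPrimitiveRing (RngPoly R) := by
  constructor
  · rintro H R _ hR ⟨Q, hmax, ⟨hQ, b, hb⟩, -⟩
    obtain ⟨a, ha⟩ := H.quasiRegular hR b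
    have hbQ : b ∈ Q := ha ▸ hb a
    refine hmax.prop.2 (eq_top_iff.2 fun c _ => ?_)
    have := Q.add_mem (hb c) (hQ b hbQ c)
    rwa [sub_add_cancel] at this
  · intro H
    exact koethe_of_quasiRegular (quasiRegular_of_not_primitive H)
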